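/- Let $r\ge 1$, let $\mathfrak g=\mathfrak{sl}_{r+1}(\mathbb C)$ with the Cartan subalgebra of diagonal matrices and the Borel subalgebra of upper triangular matrices, and let $E_{p,q}$ denote the matrix units. Let $\underline\lambda=(\lambda_1,\dots,\lambda_{r+1})$ be a tuple of real numbers whose consecutive differences $\lambda_i-\lambda_{i+1}$ are non-negative integers, let $V(\lambda)$ be the irreducible $\mathfrak g$-module with highest weight $\lambda=\sum_i\lambda_i\epsilon_i$ (where $\epsilon_i$ picks the $i$-th diagonal entry), and let $v_\lambda\in V(\lambda)$ be a non-zero vector of weight $\lambda$. An integral Gelfand–Tsetlin pattern $P$ with bounding sequence $\underline\lambda$ is a family of real numbers $(\lambda^j_i)_{1\le i\le j\le r+1}$ with $\lambda^{r+1}_i=\lambda_i$ such that $\lambda^{j}_i-\lambda^{j-1}_i$ and $\lambda^{j-1}_i-\lambda^{j}_{i+1}$ are non-negative integers for all $1\le i<j\le r+1$. Put $\ell^j_i=\lambda^j_i-i+1$. The weight of $P$ is $(\mu_1,\dots,\mu_{r+1})$ with $\mu_k=\sum_{i\le k}\lambda^k_i-\sum_{i\le k-1}\lambda^{k-1}_i$.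 Write $\mathcal P(\underline\lambda)$ for the set of these patterns, partially ordered by row-wise dominance: $P'\ge P$ if $\lambda'^j_1+\cdots+\lambda'^j_i\ge\lambda^j_1+\cdots+\lambda^j_i$ for all $1\le i\le j\le r+1$. A Gelfand–Tsetlin basis of $V(\lambda)$ is a basis $(\xi_P)_{P\in\mathcal P(\underline\lambda)}$ with $\xi_P=v_\lambda$ for the unique pattern $P$ of weight $\underline\lambda$ and, for all $1\le k\le r$ and all $P$, $$(E_{k,k}-E_{k+1,k+1})\xi_P=(\mu_k-\mu_{k+1})\,\xi_P,$$ $$E_{k,k+1}\xi_P=-\sum_{i=1}^k\frac{\prod_{p=1}^{k+1}(\ell^k_i-\ell^{k+1}_p)}{\prod_{1\le p\le k,\,p\ne i}(\ell^k_i-\ell^k_p)}\,\xi_{P+\delta^k_i},\qquad E_{k+1,k}\xi_P=\sum_{i=1}^k\frac{\prod_{p=1}^{k-1}(\ell^k_i-\ell^{k-1}_p)}{\prod_{1\le p\le k,\,p\ne i}(\ell^k_i-\ell^k_p)}\,\xi_{P-\delta^k_i},$$ where $P\pm\delta^k_i$ is $P$ with $\lambda^k_i$ replaced by $\lambda^k_i\pm1$,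 and $\xi_{P\pm\delta^k_i}=0$ if this is not a pattern. The Chari–Loktev vectors are $v_P=\rho_P^1\rho_P^2\cdots\rho_P^r\,v_\lambda$ with $\rho_P^j=\prod_{i=1}^j E_{j+1,i}^{(\ell^{j+1}_i-\ell^j_i)}$, where $T^{(n)}=T^n/n!$ (the factors of $\rho^j_P$ commute). **Theorem.** The vectors $v_P$, $P\in\mathcal P(\underline\lambda)$, form a basis of $V(\lambda)$, and $V(\lambda)$ has a Gelfand–Tsetlin basis. For every Gelfand–Tsetlin basis $(\xi_P)$, the transition matrix between the two bases is triangular with respect to row-wise dominance: for every $P\in\mathcal P(\underline\lambda)$, $$v_P=\sum_{P'\ge P}c_P^{P'}\,\xi_{P'}$$ with complex coefficients $c_P^{P'}$, and the diagonal coefficients are $$c_P^P=\prod_{1\le i<j\le r+1}\ \prod_{p=i}^{j-1}\frac{(\ell^{j-1}_i-\ell^{j-1}_p)!}{(\ell^j_i-\ell^{j-1}_p)!}.$$ -/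

import Mathlib

noncomputable section

namespace GTCL

/-- The Lie algebra `sl_{r+1}(ℂ)` of trace-zero complex matrices of size `r + 1`. -/
abbrev slC (r : ℕ) : Type := LieAlgebra.SpecialLinear.sl (Fin (r + 1)) ℂ

/-! ### Weights and highest weight vectors -/

/-- The `(r+1)`-tuple `lam` represents a dominant integral weight: all consecutive differences are
non-negative integers. -/
def IsDominantIntegral {r : ℕ} (lam : Fin (r + 1) → ℝ) : Prop :=
  ∀ i : Fin r, ∃ n : ℕ, lam i.castSucc - lam i.succ = n

/-- `v` is a highest weight vector of weight `∑ lam i • ε i`, with respect to the diagonal Cartan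
subalgebra and the upper triangular Borel subalgebra. -/
structure IsHighestWeightVector {r : ℕ} (lam : Fin (r + 1) → ℝ) {V : Type*} [AddCommGroup V]
    [Module ℂ V] [LieRingModule (slC r) V] (v : V) : Prop where
  ne_zero : v ≠ 0
  weight : ∀ x : slC r, x.val.IsDiag → ⁅x, v⁆ = (∑ i, (lam i : ℂ) * x.val i i) • v
  upper : ∀ x : slC r, (∀ i j, j ≤ i → x.val i j = 0) → ⁅x, v⁆ = 0

/-! ### Integral Gelfand–Tsetlin patterns

Rows `j` and positions `i` are numbered from `1`, so that the entries are those at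
`1 ≤ i ≤ j ≤ r + 1`; outside this range the entry function is zero. -/

/-- `f j i` (the entry of row `j` in position `i`) is an integral Gelfand–Tsetlin pattern with
bounding sequence `lam`. The rows are then automatically non-increasing. -/
structure IsPattern {r : ℕ} (lam : Fin (r + 1) → ℝ) (f : ℕ → ℕ → ℝ) : Prop where
  outside : ∀ j i, ¬ (1 ≤ i ∧ i ≤ j ∧ j ≤ r + 1) → f j i = 0
  bounding : ∀ i : Fin (r + 1), f (r + 1) (i.val + 1) = lam i
  /-- `f (j + 1) i ≥ f j i`, the difference being an integer -/
  upper : ∀ j i, 1 ≤ i → i ≤ j → j ≤ r → ∃ n : ℕ, f (j + 1) i - f j i = n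
  /-- `f j i ≥ f (j + 1) (i + 1)`, the difference being an integer -/
  lower : ∀ j i, 1 ≤ i → i ≤ j → j ≤ r → ∃ n : ℕ, f j i - f (j + 1) (i + 1) = n

/-- The set of integral Gelfand–Tsetlin patterns with bounding sequence `lam`. -/
@[ext]
structure Pattern {r : ℕ} (lam : Fin (r + 1) → ℝ) where
  entry : ℕ → ℕ → ℝ
  isPattern : IsPattern lam entry

namespace Pattern

variable {r : ℕ} {lam : Fin (r + 1) → ℝ}

/-- `ell P j i = P.entry j i - i + 1`. -/
def ell (P : Pattern lam) (j i : ℕ) : ℝ := P.entry j i - i + 1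

/-- The sum of the entries of row `k`. -/
def rowSum (P : Pattern lam) (k : ℕ) : ℝ := ∑ i ∈ Finset.Icc 1 k, P.entry k i

/-- The `k`-th coordinate (`1 ≤ k ≤ r + 1`) of the weight of `P`. -/
def weight (P : Pattern lam) (k : ℕ) : ℝ := P.rowSum k - P.rowSum (k - 1)

/-- The row-wise dominance order. -/
instance : PartialOrder (Pattern lam) where
  le P Q := ∀ j i, 1 ≤ i → i ≤ j → j ≤ r + 1 →
    ∑ p ∈ Finset.Icc 1 i, P.entry j p ≤ ∑ p ∈ Finset.Icc 1 i, Q.entry j p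
  le_refl P j i _ _ _ := le_rfl
  le_trans P Q R h₁ h₂ j i hi hij hj := (h₁ j i hi hij hj).trans (h₂ j i hi hij hj)
  le_antisymm P Q h₁ h₂ := by
    have key : ∀ j i, i ≤ j → j ≤ r + 1 →
        ∑ p ∈ Finset.Icc 1 i, P.entry j p = ∑ p ∈ Finset.Icc 1 i, Q.entry j p := by
      intro j i hij hj
      rcases Nat.eq_zero_or_pos i with rfl | hi
      · simp
      · exact le_antisymm (h₁ j i hi hij hj) (h₂ j i hi hij hj)
    ext j i
    by_cases h : 1 ≤ i ∧ i ≤ j ∧ j ≤ r + 1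
    · obtain ⟨hi, hij, hj⟩ := h
      obtain ⟨m, rfl⟩ : ∃ m, i = m + 1 := ⟨i - 1, by omega⟩
      have a := key j (m + 1) hij hj
      have b := key j m (by omega) hj
      rw [Finset.sum_Icc_succ_top (by omega), Finset.sum_Icc_succ_top (by omega), b] at a
      exact add_left_cancel a
    · rw [P.isPattern.outside j i h, Q.isPattern.outside j i h]

end Pattern

/-! ### Elements of `sl_{r+1}` -/

/-- The matrix position numbered `k`, for `1 ≤ k ≤ r + 1`. -/
def pos (r k : ℕ) : Fin (r + 1) := Fin.ofNat (r + 1) (k - 1)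

/-- The matrix unit `E_{p,q}`, for `1 ≤ p, q ≤ r + 1` and `p ≠ q`. -/
def matUnit (r p q : ℕ) : slC r :=
  if h : pos r p ≠ pos r q then LieAlgebra.SpecialLinear.single (pos r p) (pos r q) h 1 else 0

/-- The diagonal matrix `E_{k,k} - E_{k+1,k+1}`, for `1 ≤ k ≤ r`. -/
def coroot (r k : ℕ) : slC r :=
  LieAlgebra.SpecialLinear.singleSubSingle (pos r k) (pos r (k + 1)) 1

/-! ### The Gelfand–Tsetlin basis -/

section GT

variable {r : ℕ} {lam : Fin (r + 1) → ℝ} {V : Type*} [AddCommGroup V] [Module ℂ V]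

/-- The entry function of `P` with `c` added to the entry in position `i` of row `k`. -/
def shift (P : Pattern lam) (k i : ℕ) (c : ℝ) : ℕ → ℕ → ℝ :=
  fun k' i' => if k' = k ∧ i' = i then P.entry k' i' + c else P.entry k' i'

open Classical in
/-- The vector `ξ_f`, understood to be `0` if `f` is not a pattern. -/
def extendZero (ξ : Pattern lam → V) (f : ℕ → ℕ → ℝ) : V :=
  if h : IsPattern lam f then ξ ⟨f, h⟩ else 0

/-- The coefficient of `ξ_{P + δ^k_i}` in `E_{k,k+1} ξ_P`, up to sign. -/
def raiseCoeff (P : Pattern lam) (k i : ℕ) : ℝ :=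
  (∏ p ∈ Finset.Icc 1 (k + 1), (P.ell k i - P.ell (k + 1) p)) /
    ∏ p ∈ (Finset.Icc 1 k).erase i, (P.ell k i - P.ell k p)

/-- The coefficient of `ξ_{P - δ^k_i}` in `E_{k+1,k} ξ_P`. -/
def lowerCoeff (P : Pattern lam) (k i : ℕ) : ℝ :=
  (∏ p ∈ Finset.Icc 1 (k - 1), (P.ell k i - P.ell (k - 1) p)) /
    ∏ p ∈ (Finset.Icc 1 k).erase i, (P.ell k i - P.ell k p)

/-- `ξ` is a Gelfand–Tsetlin basis of `V`, normalised by the highest weight vector `v`. -/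
structure IsGelfandTsetlin [LieRingModule (slC r) V] (v : V)
    (ξ : Module.Basis (Pattern lam) ℂ V) : Prop where
  /-- If `P` is the pattern of weight `lam`, then `ξ_P = v`. -/
  top : ∀ P : Pattern lam, (∀ i : Fin (r + 1), P.weight (i.val + 1) = lam i) → ξ P = v
  cartan : ∀ k, 1 ≤ k → k ≤ r → ∀ P : Pattern lam,
    ⁅coroot r k, ξ P⁆ = ((P.weight k - P.weight (k + 1) : ℝ) : ℂ) • ξ P
  raise : ∀ k, 1 ≤ k → k ≤ r → ∀ P : Pattern lam,
    ⁅matUnit r k (k + 1), ξ P⁆ =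
      - ∑ i ∈ Finset.Icc 1 k, (raiseCoeff P k i : ℂ) • extendZero ξ (shift P k i 1)
  lower : ∀ k, 1 ≤ k → k ≤ r → ∀ P : Pattern lam,
    ⁅matUnit r (k + 1) k, ξ P⁆ =
      ∑ i ∈ Finset.Icc 1 k, (lowerCoeff P k i : ℂ) • extendZero ξ (shift P k i (-1))

end GT

/-! ### The Chari–Loktev vectors -/

section CL

variable {r : ℕ} {lam : Fin (r + 1) → ℝ}

/-- The divided power `T ^ n / n!` of an operator. -/
def dividedPower {V : Type*} [AddCommGroup V] [Module ℂ V] (T : Module.End ℂ V) (n : ℕ) :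
    Module.End ℂ V :=
  ((n.factorial : ℂ)⁻¹) • T ^ n

variable (V : Type*) [AddCommGroup V] [Module ℂ V] [LieRingModule (slC r) V]
  [LieModule ℂ (slC r) V]

/-- The operator by which `ρ_P^j = ∏_{i=1}^{j} (E_{j+1,i}) ^ (ell^{j+1}_i - ell^j_i)`, a product of
(pairwise commuting) divided powers, acts on `V`. The exponents are non-negative integers, so that
the floor only changes their type. -/
def rhoRow (P : Pattern lam) (j : ℕ) : Module.End ℂ V :=
  ((List.range' 1 j).map fun i =>
    dividedPower (LieModule.toEnd ℂ (slC r) V (matUnit r (j + 1) i))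
      ⌊P.ell (j + 1) i - P.ell j i⌋₊).prod

/-- The action on `V` of the Chari–Loktev monomial `ρ_P = ρ_P^1 ρ_P^2 ⋯ ρ_P^r`, in this order. -/
def rho (P : Pattern lam) : Module.End ℂ V :=
  ((List.range' 1 r).map fun j => rhoRow V P j).prod

variable {V}

/-- The Chari–Loktev vector `v_P = ρ_P v`. -/
def clVector (v : V) (P : Pattern lam) : V := rho V P v

/-- The number `∏_{1 ≤ i < j ≤ r+1} ∏_{p=i}^{j-1} (ell^{j-1}_i - ell^{j-1}_p)! /
(ell^j_i - ell^{j-1}_p)!`. The arguments of the factorials are non-negative integers, so that the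
floor only changes their type. -/
def diagCoeff (P : Pattern lam) : ℂ :=
  ∏ j ∈ Finset.Icc 2 (r + 1), ∏ i ∈ Finset.Ico 1 j, ∏ p ∈ Finset.Ico i j,
    ((⌊P.ell (j - 1) i - P.ell (j - 1) p⌋₊.factorial : ℂ) /
      (⌊P.ell j i - P.ell (j - 1) p⌋₊.factorial : ℂ))

end CL

end GTCL

end

/-!
The idea is to build a model of `V` on the vector space `W` with basis the Gelfand–Tsetlin
patterns, and to read off triangularity from the row sums of patterns.

*Existence of a Gelfand–Tsetlin basis.* On `W` let `e k`, `f k`, `h k` act by the Gelfand–Tsetlin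
formulas. The relations `[e k, f l] = δ h k` and `[h k, f l] = -a_{kl} f l` hold on `W`: away from
the diagonal the coefficients of any two paths agree (`path_coeff_eq`), and on the diagonal the
relation is a sum of residues of a rational function (`interlacing_identity`). Serre relations are
not needed. A vector of `W` killed by all `e k` is a multiple of `ξ_top` (`eq_smul_of_singular`),
and `ξ_top` generates `W` under the `f k` because the monomial vectors span, by triangularity. So
no proper non-zero subspace of `W` is stable under the `e k` and `f k`; the same is true of `V`,
as the `E_{k,k+1}` and `E_{k+1,k}` generate `sl_{r+1}`. By the relations above, the words in the
`f k` applied to `(v, ξ_top)` span a stable subspace of `V × W`, which does not contain `(v, 0)`;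
it is the graph of an isomorphism `W ≃ V` (`exists_equiv_of_isChevalley`), which carries the basis
of `W` to `V`.

*Triangularity.* The operator `E_{j+1,i}` is an iterated commutator of the `E_{k+1,k}`; it takes
`ξ_P` to a combination of `ξ_Q` with `Q` entrywise at most `P`, where each of the rows `i, …, j`
has lost `1` from its sum and the other rows are unchanged (`IsLowering.drops`). Hence the sum of
row `s` of any `Q` that occurs in `ρ_P^j ⋯ ρ_P^r v`, for `s ≤ j`, is the sum of the first `s`
entries of row `j` of `P`. By interlacing, the first `s` entries of row `j` of `Q` add up to at
least the sum of row `s`, and this is dominance (`IsLowering.support_tailProd`).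

*Diagonal coefficients.* The inequalities between row sums leave only one path from `ξ_top` to
`ξ_P`: each factor `E_{j+1,s}` has to lower position `s` in all the rows `s, …, j`, and only the
term `E_{j+1,j} ⋯ E_{s+1,s}` of the iterated commutator does so through patterns. The coefficient
of such a step telescopes to a product of inverses of differences `ℓ^{j+1}_s - ℓ^j_q - t`
(`IsLowering.repr_lowerCol`), and the product of all steps is a quotient of factorials
(`factorCoeff_eq`). Since the diagonal coefficients are non-zero, the `v_P` form a basis.
-/

noncomputable section

namespace GTCL

/-! ### A Lagrange interpolation identity -/

/-- The residues of `∏ (t - y j) / ∏ (t - v i)` (two monic polynomials of the same degree, the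
nodes `v i` being distinct) add up to the residue at infinity. -/
lemma sum_prod_sub_div_prod_sub {ι : Type*} [DecidableEq ι] (s t : Finset ι) (v y : ι → ℝ)
    (hv : Set.InjOn v s) (hst : t.card = s.card) :
    ∑ i ∈ s, (∏ j ∈ t, (v i - y j)) / ∏ j ∈ s.erase i, (v i - v j)
      = ∑ i ∈ s, v i - ∑ j ∈ t, y j := by
  rcases s.eq_empty_or_nonempty with rfl | hs
  · have : t = ∅ := by simpa using hst
    simp [this]
  have hpos : 0 < s.card := hs.card_pos
  have hdeg : (Lagrange.nodal t y - Lagrange.nodal s v).degree < s.card := by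
    have h := Polynomial.degree_sub_lt_left (p := Lagrange.nodal t y) (q := Lagrange.nodal s v)
      (by rw [Lagrange.degree_nodal, Lagrange.degree_nodal, hst]) Lagrange.nodal_ne_zero
      (by rw [Lagrange.nodal_monic, Lagrange.nodal_monic])
    rwa [Lagrange.degree_nodal, hst] at h
  have h := Lagrange.coeff_eq_sum hv hdeg
  rw [Polynomial.coeff_sub, Lagrange.nodal_eq, Lagrange.nodal_eq,
    Polynomial.prod_X_sub_C_coeff_card_pred s v hpos] at h
  nth_rewrite 1 [← hst] at h
  rw [Polynomial.prod_X_sub_C_coeff_card_pred t y (hst ▸ hpos)] at h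
  rw [show ∑ i ∈ s, v i - ∑ j ∈ t, y j = -∑ j ∈ t, y j - -∑ i ∈ s, v i by ring, h]
  refine Finset.sum_congr rfl fun i hi => ?_
  rw [Polynomial.eval_sub, ← Lagrange.nodal_eq, ← Lagrange.nodal_eq, Lagrange.eval_nodal,
    Lagrange.eval_nodal_at_node hi, sub_zero]

/-- The same identity when the nodes in `c` may coincide among themselves, but are cancelled by
zeros of the numerator. The terms belonging to `c` are then zero, by `0 / 0 = 0`. -/
lemma sum_prod_sub_div_prod_sub_of_cancel {ι : Type*} [DecidableEq ι] (s t c : Finset ι)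
    (v y : ι → ℝ) (hcs : c ⊆ s) (hct : c ⊆ t) (hc : ∀ i ∈ c, v i = y i)
    (hv : Set.InjOn v (s \ c : Finset ι)) (hvc : ∀ i ∈ s \ c, ∀ j ∈ c, v i ≠ v j)
    (hst : t.card = s.card) :
    ∑ i ∈ s, (∏ j ∈ t, (v i - y j)) / ∏ j ∈ s.erase i, (v i - v j)
      = ∑ i ∈ s, v i - ∑ j ∈ t, y j := by
  have h := sum_prod_sub_div_prod_sub (s \ c) (t \ c) v y hv (by
    rw [Finset.card_sdiff_of_subset hcs, Finset.card_sdiff_of_subset hct, hst])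
  have e1 : ∑ i ∈ s, v i - ∑ j ∈ t, y j = ∑ i ∈ s \ c, v i - ∑ j ∈ t \ c, y j := by
    rw [← Finset.sum_sdiff hcs, ← Finset.sum_sdiff hct, Finset.sum_congr rfl hc]
    ring
  rw [e1, ← h, ← Finset.sum_sdiff hcs]
  have e2 : ∑ i ∈ c, (∏ j ∈ t, (v i - y j)) / ∏ j ∈ s.erase i, (v i - v j) = 0 :=
    Finset.sum_eq_zero fun i hi => by
      rw [Finset.prod_eq_zero (hct hi) (sub_eq_zero.2 (hc i hi)), zero_div]
  rw [e2, add_zero]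
  refine Finset.sum_congr rfl fun i hi => ?_
  have hic : i ∉ c := (Finset.mem_sdiff.1 hi).2
  have hce : c ⊆ s.erase i := fun j hj =>
    Finset.mem_erase.2 ⟨fun h => hic (h ▸ hj), hcs hj⟩
  rw [← Finset.prod_sdiff hct, ← Finset.prod_sdiff hce,
    Finset.prod_congr (s₁ := c) (g := fun j => v i - v j) rfl fun j hj => by rw [← hc j hj],
    Finset.erase_sdiff_comm]
  rw [mul_div_mul_right]
  exact Finset.prod_ne_zero_iff.2 fun j hj => sub_ne_zero.2 (hvc i hi j hj)

/-- The rational identity behind `[E_{k,k+1}, E_{k+1,k}] = E_{k,k} - E_{k+1,k+1}`, for three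
interlacing rows `y`, `x`, `z` of lengths `k + 1`, `k`, `k - 1`. The nodes are the `x i` and the
`x i - 1`; those that coincide are cancelled by zeros of the numerator. -/
lemma interlacing_identity (k : ℕ) (x y z : ℕ → ℝ)
    (hy : ∀ p, 1 ≤ p → p + 1 ≤ k → x (p + 1) ≤ y (p + 1) ∧ y (p + 1) ≤ x p - 1)
    (hz : ∀ p, 1 ≤ p → p + 1 ≤ k → x (p + 1) ≤ z p - 1 ∧ z p ≤ x p) (hk : 1 ≤ k) :
    (∑ i ∈ Finset.Icc 1 k,
      ((∏ p ∈ Finset.Icc 1 (k + 1), (x i - y p)) / ∏ p ∈ (Finset.Icc 1 k).erase i, (x i - x p)) *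
      ((∏ p ∈ Finset.Icc 1 (k - 1), (x i + 1 - z p)) /
        ∏ p ∈ (Finset.Icc 1 k).erase i, (x i + 1 - x p))) -
    (∑ i ∈ Finset.Icc 1 k,
      ((∏ p ∈ Finset.Icc 1 (k - 1), (x i - z p)) / ∏ p ∈ (Finset.Icc 1 k).erase i, (x i - x p)) *
      ((∏ p ∈ Finset.Icc 1 (k + 1), (x i - 1 - y p)) /
        ∏ p ∈ (Finset.Icc 1 k).erase i, (x i - 1 - x p)))
    = 2 * ∑ i ∈ Finset.Icc 1 k, x i - ∑ i ∈ Finset.Icc 1 (k + 1), y i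
      - ∑ i ∈ Finset.Icc 1 (k - 1), z i - 1 := by
  have gap : ∀ p n, 1 ≤ p → p + n ≤ k → x (p + n) ≤ x p - n := by
    intro p n hp
    induction n with
    | zero => simp
    | succ n ih =>
      intro h
      have h1 := ih (by omega)
      have h2 := hy (p + n) (by omega) (by omega)
      push_cast
      rw [← add_assoc]
      linarith [h2.1, h2.2]
  have gap' : ∀ p q, 1 ≤ p → p < q → q ≤ k → x q ≤ x p - 1 ∧ (x q = x p - 1 → q = p + 1) := by
    intro p q hp hpq hq
    obtain ⟨n, rfl⟩ : ∃ n, q = p + (n + 1) := ⟨q - p - 1, by omega⟩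
    have h := gap p (n + 1) hp hq
    push_cast at h
    have hn : (0 : ℝ) ≤ n := n.cast_nonneg
    refine ⟨by linarith, fun h' => ?_⟩
    have : (n : ℝ) = 0 := by linarith
    have : n = 0 := by exact_mod_cast this
    omega
  have single : ∀ a b, 1 ≤ a → a ≤ k → 1 ≤ b → b ≤ k → x a = x b → a = b := by
    intro a b ha ha' hb hb' hab
    rcases lt_trichotomy a b with h | h | h
    · have := (gap' a b ha h hb').1
      linarith
    · exact h
    · have := (gap' b a hb h ha').1
      linarith
  set s : Finset (ℕ ⊕ ℕ) := (Finset.Icc 1 k).disjSum (Finset.Icc 1 k) with hs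
  set t : Finset (ℕ ⊕ ℕ) := (Finset.Icc 1 (k + 1)).disjSum (Finset.Icc 1 (k - 1)) with ht
  set v : ℕ ⊕ ℕ → ℝ := Sum.elim x (fun i => x i - 1) with hv
  set w : ℕ ⊕ ℕ → ℝ := Sum.elim y (fun i => z i - 1) with hw
  -- the nodes that occur twice
  set c : Finset (ℕ ⊕ ℕ) := ((Finset.Icc 2 k).filter fun i => x i = x (i - 1) - 1).disjSum
    ((Finset.Icc 1 (k - 1)).filter fun i => x (i + 1) = x i - 1) with hc
  have key := sum_prod_sub_div_prod_sub_of_cancel s t c v w ?_ ?_ ?_ ?_ ?_ ?_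
  · rw [hs, ht, Finset.sum_disjSum, Finset.sum_disjSum, Finset.sum_disjSum] at key
    simp only [hv, hw, Sum.elim_inl, Sum.elim_inr, Finset.prod_disjSum,
      Finset.sum_sub_distrib, Finset.sum_const, Nat.card_Icc, Nat.add_sub_cancel] at key
    have hL : ∀ i ∈ Finset.Icc 1 k,
        (∏ j ∈ ((Finset.Icc 1 k).disjSum (Finset.Icc 1 k)).erase (Sum.inl i),
          (x i - Sum.elim x (fun i => x i - 1) j)) =
        (∏ p ∈ (Finset.Icc 1 k).erase i, (x i - x p)) *
          ∏ p ∈ (Finset.Icc 1 k).erase i, (x i + 1 - x p) := by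
      intro i hi
      have : ((Finset.Icc 1 k).disjSum (Finset.Icc 1 k)).erase (Sum.inl i)
          = ((Finset.Icc 1 k).erase i).disjSum (Finset.Icc 1 k) := by
        ext (a | a) <;> simp
      rw [this, Finset.prod_disjSum]
      simp only [Sum.elim_inl, Sum.elim_inr]
      rw [← Finset.mul_prod_erase _ (fun p => x i - (x p - 1)) hi]
      simp only [sub_sub_cancel, one_mul]
      congr 1
      exact Finset.prod_congr rfl fun p _ => by ring
    have hR : ∀ i ∈ Finset.Icc 1 k,
        (∏ j ∈ ((Finset.Icc 1 k).disjSum (Finset.Icc 1 k)).erase (Sum.inr i),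
          (x i - 1 - Sum.elim x (fun i => x i - 1) j)) =
        -((∏ p ∈ (Finset.Icc 1 k).erase i, (x i - x p)) *
          ∏ p ∈ (Finset.Icc 1 k).erase i, (x i - 1 - x p)) := by
      intro i hi
      have : ((Finset.Icc 1 k).disjSum (Finset.Icc 1 k)).erase (Sum.inr i)
          = (Finset.Icc 1 k).disjSum ((Finset.Icc 1 k).erase i) := by
        ext (a | a) <;> simp
      rw [this, Finset.prod_disjSum]
      simp only [Sum.elim_inl, Sum.elim_inr]
      rw [← Finset.mul_prod_erase _ (fun p => x i - 1 - x p) hi]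
      simp only [sub_sub_cancel_left, sub_sub_sub_cancel_right]
      ring
    rw [Finset.sum_congr rfl fun i hi => by rw [hL i hi]] at key
    have hsum := Finset.sum_congr (s₁ := Finset.Icc 1 k) rfl fun i hi =>
      congrArg (fun d => ((∏ p ∈ Finset.Icc 1 (k + 1), (x i - 1 - y p)) *
        ∏ p ∈ Finset.Icc 1 (k - 1), (x i - 1 - (z p - 1))) / d) (hR i hi)
    rw [hsum] at key
    simp only [div_neg, Finset.sum_neg_distrib, sub_sub_sub_cancel_right] at key
    have e : ∀ i, ∏ p ∈ Finset.Icc 1 (k - 1), (x i - (z p - 1))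
        = ∏ p ∈ Finset.Icc 1 (k - 1), (x i + 1 - z p) := fun i =>
      Finset.prod_congr rfl fun p _ => by ring
    simp only [e, mul_div_mul_comm] at key
    have swap : ∀ i ∈ Finset.Icc 1 k,
        ((∏ p ∈ Finset.Icc 1 (k - 1), (x i - z p)) /
          ∏ p ∈ (Finset.Icc 1 k).erase i, (x i - x p)) *
        ((∏ p ∈ Finset.Icc 1 (k + 1), (x i - 1 - y p)) /
          ∏ p ∈ (Finset.Icc 1 k).erase i, (x i - 1 - x p)) =
        ((∏ p ∈ Finset.Icc 1 (k + 1), (x i - 1 - y p)) /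
          ∏ p ∈ (Finset.Icc 1 k).erase i, (x i - x p)) *
        ((∏ p ∈ Finset.Icc 1 (k - 1), (x i - z p)) /
          ∏ p ∈ (Finset.Icc 1 k).erase i, (x i - 1 - x p)) := fun i _ => by
      rw [div_mul_div_comm, div_mul_div_comm, mul_comm (∏ p ∈ Finset.Icc 1 (k - 1), _)]
    rw [sub_eq_add_neg, Finset.sum_congr rfl swap, key]
    simp only [nsmul_eq_mul, Nat.cast_sub hk]
    push_cast
    ring
  · rintro (a | a) ha <;> simp [hc, hs] at ha ⊢ <;> omega
  · rintro (a | a) ha <;> simp [hc, ht] at ha ⊢ <;> omega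
  · rintro (a | a) ha
    · simp only [hc, Finset.inl_mem_disjSum, Finset.mem_filter, Finset.mem_Icc] at ha
      have h := hy (a - 1) (by omega) (by omega)
      rw [show a - 1 + 1 = a by omega] at h
      simp only [hv, hw, Sum.elim_inl]
      linarith [h.1, h.2, ha.2]
    · simp only [hc, Finset.inr_mem_disjSum, Finset.mem_filter, Finset.mem_Icc] at ha
      have h := hz a (by omega) (by omega)
      simp only [hv, hw, Sum.elim_inr]
      linarith [h.1, h.2, ha.2]
  · -- two nodes that occur once are distinct
    have mixed : ∀ a b, Sum.inl a ∈ s \ c → Sum.inr b ∈ s \ c → x a ≠ x b - 1 := by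
      intro a b ha hb hab
      simp [hs, hc] at ha hb
      rcases lt_trichotomy a b with h | h | h
      · have := (gap' a b (by omega) h (by omega)).1
        linarith
      · subst h; linarith
      · have := (gap' b a (by omega) h (by omega)).2 hab
        subst this
        exact hb.2 (by omega) (by omega) hab
    rintro (a | a) ha (b | b) hb hab <;> rw [Finset.mem_coe] at ha hb <;>
      simp only [hv, Sum.elim_inl, Sum.elim_inr] at hab
    · simp [hs] at ha hb
      rw [single a b (by omega) (by omega) (by omega) (by omega) hab]
    · exact absurd hab (mixed a b ha hb)
    · exact absurd hab.symm (mixed b a hb ha)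
    · simp [hs] at ha hb
      rw [single a b (by omega) (by omega) (by omega) (by omega) (by linarith)]
  · -- a node that occurs once differs from one that occurs twice
    rintro (a | a) ha (b | b) hb hab <;>
      simp only [hv, Sum.elim_inl, Sum.elim_inr] at hab <;> simp [hs, hc] at ha hb
    · have := single a b (by omega) (by omega) (by omega) (by omega) hab
      subst this
      exact ha.2 (by omega) (by omega) hb.2
    · have := single a (b + 1) (by omega) (by omega) (by omega) (by omega) (by rw [hab, hb.2])
      subst this
      exact ha.2 (by omega) (by omega) hb.2
    · have := single a (b - 1) (by omega) (by omega) (by omega) (by omega) (by linarith [hb.2])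
      subst this
      rw [show b - 1 + 1 = b by omega] at ha
      exact ha.2 (by omega) (by omega) hb.2
    · have := single a b (by omega) (by omega) (by omega) (by omega) (by linarith)
      subst this
      exact ha.2 (by omega) (by omega) hb.2
  · simp [hs, ht]; omega

/-! ### Gelfand–Tsetlin patterns -/

section Patterns

variable {r : ℕ} {lam : Fin (r + 1) → ℝ} {f g : ℕ → ℕ → ℝ}

lemma IsPattern.le_up (hf : IsPattern lam f) {j i : ℕ} (hi : 1 ≤ i) (hij : i ≤ j) (hj : j ≤ r) :
    f j i ≤ f (j + 1) i := by
  obtain ⟨n, hn⟩ := hf.upper j i hi hij hj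
  have : (0 : ℝ) ≤ n := n.cast_nonneg
  linarith

lemma IsPattern.up_le (hf : IsPattern lam f) {j i : ℕ} (hi : 1 ≤ i) (hij : i ≤ j) (hj : j ≤ r) :
    f (j + 1) (i + 1) ≤ f j i := by
  obtain ⟨n, hn⟩ := hf.lower j i hi hij hj
  have : (0 : ℝ) ≤ n := n.cast_nonneg
  linarith

lemma IsPattern.mono_row (hf : IsPattern lam f) {j m i : ℕ} (hi : 1 ≤ i) (hij : i ≤ j)
    (hjm : j ≤ m) (hm : m ≤ r + 1) : f j i ≤ f m i := by
  induction m, hjm using Nat.le_induction with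
  | base => exact le_rfl
  | succ m hjm ih => exact (ih (by omega)).trans (hf.le_up hi (by omega) (by omega))

lemma IsPattern.succ_le (hf : IsPattern lam f) {j i : ℕ} (hi : 1 ≤ i) (hij : i + 1 ≤ j)
    (hj : j ≤ r + 1) : f j (i + 1) ≤ f j i := by
  obtain ⟨m, rfl⟩ : ∃ m, j = m + 1 := ⟨j - 1, by omega⟩
  exact (hf.up_le hi (by omega) (by omega)).trans (hf.le_up hi (by omega) (by omega))

lemma IsPattern.antitone (hf : IsPattern lam f) {j i p : ℕ} (hi : 1 ≤ i) (hip : i ≤ p)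
    (hp : p ≤ j) (hj : j ≤ r + 1) : f j p ≤ f j i := by
  induction p, hip using Nat.le_induction with
  | base => exact le_rfl
  | succ p hip ih => exact (hf.succ_le (by omega) hp hj).trans (ih (by omega))

/-- A function that differs from a pattern by integers, away from the top row, is a pattern as soon
as it satisfies the interlacing inequalities. -/
lemma IsPattern.of_int (hf : IsPattern lam f) (hz : ∀ j i, ∃ z : ℤ, g j i = f j i + z)
    (hout : ∀ j i, ¬ (1 ≤ i ∧ i ≤ j ∧ j ≤ r) → g j i = f j i)
    (h1 : ∀ j i, 1 ≤ i → i ≤ j → j ≤ r → g j i ≤ g (j + 1) i)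
    (h2 : ∀ j i, 1 ≤ i → i ≤ j → j ≤ r → g (j + 1) (i + 1) ≤ g j i) : IsPattern lam g where
  outside j i h := by rw [hout j i fun h' => h ⟨h'.1, h'.2.1, by omega⟩, hf.outside j i h]
  bounding i := by rw [hout _ _ (by omega), hf.bounding]
  upper j i hi hij hj := by
    obtain ⟨n, hn⟩ := hf.upper j i hi hij hj
    obtain ⟨a, ha⟩ := hz j i
    obtain ⟨b, hb⟩ := hz (j + 1) i
    have e : g (j + 1) i - g j i = ((n + b - a : ℤ) : ℝ) := by push_cast; linarith
    have h0 : 0 ≤ (n + b - a : ℤ) := by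
      have := h1 j i hi hij hj
      rw [← sub_nonneg, e] at this
      exact_mod_cast this
    obtain ⟨m, hm⟩ := Int.eq_ofNat_of_zero_le h0
    exact ⟨m, by rw [e, hm]; simp⟩
  lower j i hi hij hj := by
    obtain ⟨n, hn⟩ := hf.lower j i hi hij hj
    obtain ⟨a, ha⟩ := hz j i
    obtain ⟨b, hb⟩ := hz (j + 1) (i + 1)
    have e : g j i - g (j + 1) (i + 1) = ((n + a - b : ℤ) : ℝ) := by push_cast; linarith
    have h0 : 0 ≤ (n + a - b : ℤ) := by
      have := h2 j i hi hij hj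
      rw [← sub_nonneg, e] at this
      exact_mod_cast this
    obtain ⟨m, hm⟩ := Int.eq_ofNat_of_zero_le h0
    exact ⟨m, by rw [e, hm]; simp⟩

/-- `f` with `c` added to the entry in position `i` of row `k`. -/
def bump (f : ℕ → ℕ → ℝ) (k i : ℕ) (c : ℝ) : ℕ → ℕ → ℝ :=
  fun k' i' => if k' = k ∧ i' = i then f k' i' + c else f k' i'

lemma shift_eq_bump (P : Pattern lam) (k i : ℕ) (c : ℝ) : shift P k i c = bump P.entry k i c := rfl

lemma bump_self (f : ℕ → ℕ → ℝ) (k i : ℕ) (c : ℝ) : bump f k i c k i = f k i + c := by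
  simp [bump]

lemma bump_of_ne (f : ℕ → ℕ → ℝ) {k i k' i' : ℕ} (c : ℝ) (h : ¬ (k' = k ∧ i' = i)) :
    bump f k i c k' i' = f k' i' := by
  simp [bump, h]

lemma bump_comm (f : ℕ → ℕ → ℝ) (k i l j : ℕ) (c d : ℝ) :
    bump (bump f k i c) l j d = bump (bump f l j d) k i c := by
  ext a b
  simp only [bump]
  split_ifs <;> ring

lemma bump_bump_neg (f : ℕ → ℕ → ℝ) (k i : ℕ) (c d : ℝ) (h : c + d = 0) :
    bump (bump f k i c) k i d = f := by
  ext a b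
  simp only [bump]
  split_ifs
  · rw [add_assoc, h, add_zero]
  · rfl

lemma bump_injective {k i j : ℕ} {c : ℝ} (hc : c ≠ 0) (h : bump f k i c = bump f k j c) :
    i = j := by
  by_contra hij
  have := congrFun (congrFun h k) i
  rw [bump_self, bump_of_ne _ _ (by tauto)] at this
  exact hc (by linarith)

/-- An entry of a pattern can be lowered by one if this respects the strict inequalities with its
two lower neighbours. -/
lemma IsPattern.lower_one (hf : IsPattern lam f) {k i : ℕ} (hi : 1 ≤ i) (hik : i ≤ k) (hk : k ≤ r)
    (h1 : f (k + 1) (i + 1) < f k i) (h2 : i + 1 ≤ k → f (k - 1) i < f k i) :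
    IsPattern lam (bump f k i (-1)) := by
  refine hf.of_int (fun j p => ?_)
      (fun j p h => bump_of_ne _ _ (by rintro ⟨rfl, rfl⟩; exact h ⟨hi, hik, hk⟩))
    (fun j p hp hpj hj => ?_) (fun j p hp hpj hj => ?_)
  · by_cases h : j = k ∧ p = i
    · rw [h.1, h.2, bump_self]; exact ⟨-1, by simp⟩
    · rw [bump_of_ne _ _ h]; exact ⟨0, by simp⟩
  · have h0 := hf.le_up hp hpj hj
    simp only [bump]
    split_ifs with a b b
    · linarith
    · linarith
    · obtain ⟨rfl, rfl⟩ := b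
      rw [Nat.add_sub_cancel] at h2
      have h2 := h2 (by omega)
      obtain ⟨n, hn⟩ := hf.upper j p hp hpj hj
      have : (0 : ℝ) < n := by rw [← hn]; linarith
      have : (1 : ℝ) ≤ n := by exact_mod_cast this
      linarith
    · exact h0
  · have h0 := hf.up_le hp hpj hj
    simp only [bump]
    split_ifs with a b b
    · linarith
    · linarith
    · obtain ⟨rfl, rfl⟩ := b
      obtain ⟨n, hn⟩ := hf.lower j p hp hpj hj
      have : (0 : ℝ) < n := by rw [← hn]; linarith
      have : (1 : ℝ) ≤ n := by exact_mod_cast this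
      linarith
    · exact h0

/-- An entry of a pattern can be raised by one if this respects the strict inequalities with its
two upper neighbours. -/
lemma IsPattern.raise_one (hf : IsPattern lam f) {k i : ℕ} (hi : 1 ≤ i) (hik : i ≤ k) (hk : k ≤ r)
    (h1 : f k i < f (k + 1) i) (h2 : 2 ≤ i → f k i < f (k - 1) (i - 1)) :
    IsPattern lam (bump f k i 1) := by
  refine hf.of_int (fun j p => ?_)
      (fun j p h => bump_of_ne _ _ (by rintro ⟨rfl, rfl⟩; exact h ⟨hi, hik, hk⟩))
    (fun j p hp hpj hj => ?_) (fun j p hp hpj hj => ?_)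
  · by_cases h : j = k ∧ p = i
    · rw [h.1, h.2, bump_self]; exact ⟨1, by simp⟩
    · rw [bump_of_ne _ _ h]; exact ⟨0, by simp⟩
  · have h0 := hf.le_up hp hpj hj
    simp only [bump]
    split_ifs with a b b
    · linarith
    · obtain ⟨rfl, rfl⟩ := a
      obtain ⟨n, hn⟩ := hf.upper j p hp hpj hj
      have : (0 : ℝ) < n := by rw [← hn]; linarith
      have : (1 : ℝ) ≤ n := by exact_mod_cast this
      linarith
    · linarith
    · exact h0
  · have h0 := hf.up_le hp hpj hj
    simp only [bump]
    split_ifs with a b b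
    · linarith
    · obtain ⟨rfl, rfl⟩ := a
      have h2 := h2 (by omega)
      rw [Nat.add_sub_cancel, Nat.add_sub_cancel] at h2
      obtain ⟨n, hn⟩ := hf.lower j p hp hpj hj
      have : (0 : ℝ) < n := by rw [← hn]; linarith
      have : (1 : ℝ) ≤ n := by exact_mod_cast this
      linarith
    · linarith
    · exact h0

/-- If one entry of a pattern can be lowered and another one raised, simultaneously, then each of
the two can be done alone. -/
lemma IsPattern.of_bump_bump (hf : IsPattern lam f) {k i l j : ℕ}
    (hk : 1 ≤ i ∧ i ≤ k ∧ k ≤ r) (hl : 1 ≤ j ∧ j ≤ l ∧ l ≤ r) (hne : ¬ (k = l ∧ i = j))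
    (hg : IsPattern lam (bump (bump f k i (-1)) l j 1)) :
    IsPattern lam (bump f k i (-1)) ∧ IsPattern lam (bump f l j 1) := by
  have key : ∀ a b a' b', f a b ≤ f a' b' →
      bump (bump f k i (-1)) l j 1 a b ≤ bump (bump f k i (-1)) l j 1 a' b' →
      bump f k i (-1) a b ≤ bump f k i (-1) a' b' ∧ bump f l j 1 a b ≤ bump f l j 1 a' b' := by
    intro a b a' b' h1 h2
    simp only [bump] at h2 ⊢
    constructor
    · split_ifs at h2 ⊢ <;> first | linarith | omega
    · split_ifs at h2 ⊢ <;> first | linarith | omega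
  constructor
  · refine hf.of_int (fun j p => ?_)
      (fun j p h => bump_of_ne _ _ (by rintro ⟨rfl, rfl⟩; exact h hk))
      (fun j p hp hpj hj => (key _ _ _ _ (hf.le_up hp hpj hj) (hg.le_up hp hpj hj)).1)
      (fun j p hp hpj hj => (key _ _ _ _ (hf.up_le hp hpj hj) (hg.up_le hp hpj hj)).1)
    by_cases h : j = k ∧ p = i
    · rw [h.1, h.2, bump_self]; exact ⟨-1, by simp⟩
    · rw [bump_of_ne _ _ h]; exact ⟨0, by simp⟩
  · refine hf.of_int (fun a p => ?_)
      (fun j p h => bump_of_ne _ _ (by rintro ⟨rfl, rfl⟩; exact h hl))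
      (fun j p hp hpj hj => (key _ _ _ _ (hf.le_up hp hpj hj) (hg.le_up hp hpj hj)).2)
      (fun j p hp hpj hj => (key _ _ _ _ (hf.up_le hp hpj hj) (hg.up_le hp hpj hj)).2)
    by_cases h : a = l ∧ p = j
    · rw [h.1, h.2, bump_self]; exact ⟨1, by simp⟩
    · rw [bump_of_ne _ _ h]; exact ⟨0, by simp⟩

lemma IsPattern.le_lam_zero (hf : IsPattern lam f) {j i : ℕ} (hi : 1 ≤ i) (hij : i ≤ j)
    (hj : j ≤ r + 1) : f j i ≤ lam 0 := by
  have h := hf.bounding 0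
  simp only [Fin.val_zero, zero_add] at h
  rw [← h]
  exact (hf.mono_row hi hij hj le_rfl).trans (hf.antitone le_rfl hi (by omega) le_rfl)

lemma IsPattern.lam_last_le (hf : IsPattern lam f) {j i : ℕ} (hi : 1 ≤ i) (hij : i ≤ j)
    (hj : j ≤ r + 1) : lam (Fin.last r) ≤ f j i := by
  have h := hf.bounding (Fin.last r)
  simp only [Fin.val_last] at h
  rw [← h]
  have : ∀ n, j + n ≤ r + 1 → f (j + n) (i + n) ≤ f j i := by
    intro n
    induction n with
    | zero => intro _; exact le_rfl
    | succ n ih =>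
      intro hn
      exact (hf.up_le (j := j + n) (i := i + n) (by omega) (by omega) (by omega)).trans
        (ih (by omega))
  obtain ⟨n, hn⟩ : ∃ n, j + n = r + 1 := ⟨r + 1 - j, by omega⟩
  have h1 := this n (by omega)
  rw [hn] at h1
  exact (hf.antitone (by omega) (by omega) le_rfl le_rfl).trans h1

lemma IsPattern.exists_int (hf : IsPattern lam f) {j i : ℕ} (hi : 1 ≤ i) (hij : i ≤ j)
    (hj : j ≤ r + 1) : ∃ z : ℤ, f j i = lam 0 + z := by
  have top : ∀ i, 1 ≤ i → i ≤ r + 1 → ∃ z : ℤ, f (r + 1) i = lam 0 + z := by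
    intro i hi
    induction i, hi using Nat.le_induction with
    | base => intro _; exact ⟨0, by simpa using hf.bounding 0⟩
    | succ i hi ih =>
      intro h
      obtain ⟨z, hz⟩ := ih (by omega)
      obtain ⟨n, hn⟩ := hf.lower r i hi (by omega) le_rfl
      obtain ⟨m, hm⟩ := hf.upper r i hi (by omega) le_rfl
      exact ⟨z - m - n, by push_cast; linarith⟩
  have : ∀ n, j + n = r + 1 → ∃ z : ℤ, f j i = lam 0 + z := by
    intro n
    induction n generalizing j with
    | zero => intro h; rw [add_zero] at h; subst h; exact top i hi hij
    | succ n ih =>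
      intro hn
      obtain ⟨z, hz⟩ := ih (j := j + 1) (by omega) (by omega) (by omega)
      obtain ⟨m, hm⟩ := hf.upper j i hi (by omega) (by omega)
      exact ⟨z - m, by push_cast; linarith⟩
  exact this (r + 1 - j) (by omega)

/-- The entries of a pattern lie between the extreme entries of `lam`, and differ from `lam 0` by
integers. -/
instance finite_pattern : Finite (Pattern lam) := by
  set N : ℤ := ⌈lam (Fin.last r) - lam 0⌉ with hN
  let φ : Pattern lam → (Fin (r + 2) → Fin (r + 2) → Set.Icc (min N 0) 0) := fun P j i =>
    if h : 1 ≤ i.val ∧ i.val ≤ j.val then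
      ⟨(P.isPattern.exists_int h.1 h.2 (by omega)).choose, by
        have h0 := (P.isPattern.exists_int h.1 h.2 (by omega)).choose_spec
        have h1 := P.isPattern.le_lam_zero h.1 h.2 (by omega)
        have h2 := P.isPattern.lam_last_le h.1 h.2 (by omega)
        refine ⟨min_le_of_left_le ?_, ?_⟩
        · rw [hN, Int.ceil_le]; linarith
        · have : ((P.isPattern.exists_int h.1 h.2 (by omega)).choose : ℝ) ≤ 0 := by linarith
          exact_mod_cast this⟩
    else ⟨0, by simp⟩
  refine Finite.of_injective φ fun P Q h => ?_
  ext j i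
  by_cases hji : 1 ≤ i ∧ i ≤ j ∧ j ≤ r + 1
  · have e := congrArg Subtype.val (congrFun (congrFun h ⟨j, by omega⟩) ⟨i, by omega⟩)
    simp only [φ] at e
    rw [dif_pos ⟨hji.1, hji.2.1⟩, dif_pos ⟨hji.1, hji.2.1⟩] at e
    simp only at e
    rw [(P.isPattern.exists_int hji.1 hji.2.1 hji.2.2).choose_spec,
      (Q.isPattern.exists_int hji.1 hji.2.1 hji.2.2).choose_spec, e]
  · rw [P.isPattern.outside j i hji, Q.isPattern.outside j i hji]

end Patterns

/-! ### The Gelfand–Tsetlin operators -/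

section Coefficients

variable {r : ℕ} {lam : Fin (r + 1) → ℝ}

/-- The number `ℓ^j_i` of an entry function. -/
def rowEll (f : ℕ → ℕ → ℝ) (j i : ℕ) : ℝ := f j i - i + 1

/-- The coefficient `raiseCoeff` of an arbitrary entry function. -/
def rowRaise (f : ℕ → ℕ → ℝ) (k i : ℕ) : ℝ :=
  (∏ p ∈ Finset.Icc 1 (k + 1), (rowEll f k i - rowEll f (k + 1) p)) /
    ∏ p ∈ (Finset.Icc 1 k).erase i, (rowEll f k i - rowEll f k p)

/-- The coefficient `lowerCoeff` of an arbitrary entry function. -/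
def rowLower (f : ℕ → ℕ → ℝ) (k i : ℕ) : ℝ :=
  (∏ p ∈ Finset.Icc 1 (k - 1), (rowEll f k i - rowEll f (k - 1) p)) /
    ∏ p ∈ (Finset.Icc 1 k).erase i, (rowEll f k i - rowEll f k p)

lemma raiseCoeff_eq (P : Pattern lam) (k i : ℕ) : raiseCoeff P k i = rowRaise P.entry k i := rfl

lemma lowerCoeff_eq (P : Pattern lam) (k i : ℕ) : lowerCoeff P k i = rowLower P.entry k i := rfl

lemma rowEll_bump_self (f : ℕ → ℕ → ℝ) (k i : ℕ) (c : ℝ) :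
    rowEll (bump f k i c) k i = rowEll f k i + c := by
  rw [rowEll, bump_self, rowEll]; ring

lemma rowEll_bump_of_ne (f : ℕ → ℕ → ℝ) {k i k' i' : ℕ} (c : ℝ) (h : ¬ (k' = k ∧ i' = i)) :
    rowEll (bump f k i c) k' i' = rowEll f k' i' := by
  rw [rowEll, bump_of_ne _ _ h, rowEll]

/-- Lowering one entry and raising another one commute, on the level of coefficients. -/
lemma rowLower_mul_rowRaise (f : ℕ → ℕ → ℝ) {k j l i : ℕ} (hk : 1 ≤ j ∧ j ≤ k)
    (hl : 1 ≤ i ∧ i ≤ l) (hne : ¬ (l = k ∧ i = j)) :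
    rowLower f l i * rowRaise (bump f l i (-1)) k j
      = rowRaise f k j * rowLower (bump f k j 1) l i := by
  by_cases h1 : l = k
  · subst h1
    have hij : i ≠ j := fun h => hne ⟨rfl, h⟩
    have ei : i ∈ (Finset.Icc 1 l).erase j := by simp [hij, hl]
    have ej : j ∈ (Finset.Icc 1 l).erase i := by simp [hij.symm, hk]
    have A : rowRaise (bump f l i (-1)) l j =
        (∏ p ∈ Finset.Icc 1 (l + 1), (rowEll f l j - rowEll f (l + 1) p)) /
        ((rowEll f l j - rowEll f l i + 1) *
          ∏ p ∈ ((Finset.Icc 1 l).erase j).erase i, (rowEll f l j - rowEll f l p)) := by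
      rw [rowRaise, ← Finset.mul_prod_erase _ _ ei, rowEll_bump_self,
        rowEll_bump_of_ne f _ (show ¬ (l = l ∧ j = i) by tauto)]
      congr 1
      · exact Finset.prod_congr rfl fun p _ => by rw [rowEll_bump_of_ne f _ (by omega)]
      · congr 1
        · ring
        · refine Finset.prod_congr rfl fun p hp => ?_
          rw [rowEll_bump_of_ne f _ (by simp at hp; tauto)]
    have B : rowLower (bump f l j 1) l i =
        (∏ p ∈ Finset.Icc 1 (l - 1), (rowEll f l i - rowEll f (l - 1) p)) /
        ((rowEll f l i - rowEll f l j - 1) *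
          ∏ p ∈ ((Finset.Icc 1 l).erase i).erase j, (rowEll f l i - rowEll f l p)) := by
      rw [rowLower, ← Finset.mul_prod_erase _ _ ej, rowEll_bump_self,
        rowEll_bump_of_ne f _ (show ¬ (l = l ∧ i = j) by tauto)]
      congr 1
      · exact Finset.prod_congr rfl fun p _ => by rw [rowEll_bump_of_ne f _ (by omega)]
      · congr 1
        · ring
        · refine Finset.prod_congr rfl fun p hp => ?_
          rw [rowEll_bump_of_ne f _ (by simp at hp; tauto)]
    rw [A, B, rowLower, rowRaise, ← Finset.mul_prod_erase _ _ ei, ← Finset.mul_prod_erase _ _ ej]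
    rw [div_mul_div_comm, div_mul_div_comm]
    congr 1 <;> ring
  by_cases h2 : l = k + 1
  · subst h2
    have ei : i ∈ Finset.Icc 1 (k + 1) := by simp [hl]
    have ej : j ∈ Finset.Icc 1 k := by simp [hk]
    have A : rowRaise (bump f (k + 1) i (-1)) k j =
        ((rowEll f k j - rowEll f (k + 1) i + 1) *
          ∏ p ∈ (Finset.Icc 1 (k + 1)).erase i, (rowEll f k j - rowEll f (k + 1) p)) /
        ∏ p ∈ (Finset.Icc 1 k).erase j, (rowEll f k j - rowEll f k p) := by
      rw [rowRaise, ← Finset.mul_prod_erase _ _ ei, rowEll_bump_self,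
        rowEll_bump_of_ne f _ (show ¬ (k = k + 1 ∧ j = i) by omega)]
      congr 1
      · congr 1
        · ring
        · refine Finset.prod_congr rfl fun p hp => ?_
          rw [rowEll_bump_of_ne f _ (by simp at hp; tauto)]
      · exact Finset.prod_congr rfl fun p _ => by rw [rowEll_bump_of_ne f _ (by omega)]
    have B : rowLower (bump f k j 1) (k + 1) i =
        ((rowEll f (k + 1) i - rowEll f k j - 1) *
          ∏ p ∈ (Finset.Icc 1 k).erase j, (rowEll f (k + 1) i - rowEll f k p)) /
        ∏ p ∈ (Finset.Icc 1 (k + 1)).erase i, (rowEll f (k + 1) i - rowEll f (k + 1) p) := by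
      rw [rowLower, Nat.add_sub_cancel, ← Finset.mul_prod_erase _ _ ej, rowEll_bump_self,
        rowEll_bump_of_ne f _ (show ¬ (k + 1 = k ∧ i = j) by omega)]
      congr 1
      · congr 1
        · ring
        · refine Finset.prod_congr rfl fun p hp => ?_
          rw [rowEll_bump_of_ne f _ (by simp at hp; tauto)]
      · exact Finset.prod_congr rfl fun p _ => by rw [rowEll_bump_of_ne f _ (by omega)]
    rw [A, B, rowLower, rowRaise, Nat.add_sub_cancel, ← Finset.mul_prod_erase _ _ ei,
      ← Finset.mul_prod_erase _ _ ej]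
    rw [div_mul_div_comm, div_mul_div_comm]
    congr 1 <;> ring
  · have A : rowRaise (bump f l i (-1)) k j = rowRaise f k j := by
      rw [rowRaise, rowRaise, rowEll_bump_of_ne f _ (by omega)]
      congr 1 <;> exact Finset.prod_congr rfl fun p _ => by rw [rowEll_bump_of_ne f _ (by omega)]
    have B : rowLower (bump f k j 1) l i = rowLower f l i := by
      rw [rowLower, rowLower, rowEll_bump_of_ne f _ (by omega)]
      congr 1 <;> exact Finset.prod_congr rfl fun p _ => by rw [rowEll_bump_of_ne f _ (by omega)]
    rw [A, B, mul_comm]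

lemma sum_rowEll (f : ℕ → ℕ → ℝ) (k : ℕ) :
    ∑ i ∈ Finset.Icc 1 k, rowEll f k i
      = ∑ i ∈ Finset.Icc 1 k, f k i - ∑ i ∈ Finset.Icc 1 k, ((i : ℝ) - 1) := by
  rw [← Finset.sum_sub_distrib]
  exact Finset.sum_congr rfl fun i _ => by rw [rowEll]; ring

open Classical in
/-- The diagonal coefficients of `[E_{k,k+1}, E_{k+1,k}]`. -/
lemma diagonal_commutator_coeff (P : Pattern lam) {k : ℕ} (hk : 1 ≤ k) (hkr : k ≤ r) :
    (∑ i ∈ Finset.Icc 1 k, (if IsPattern lam (bump P.entry k i 1) then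
        rowRaise P.entry k i * rowLower (bump P.entry k i 1) k i else 0)) -
      ∑ i ∈ Finset.Icc 1 k, (if IsPattern lam (bump P.entry k i (-1)) then
        rowLower P.entry k i * rowRaise (bump P.entry k i (-1)) k i else 0)
    = P.weight k - P.weight (k + 1) := by
  have hP := P.isPattern
  have key := interlacing_identity k (rowEll P.entry k) (rowEll P.entry (k + 1))
    (rowEll P.entry (k - 1)) ?_ ?_ hk
  · have e1 : 2 * ∑ i ∈ Finset.Icc 1 k, rowEll P.entry k i
          - ∑ i ∈ Finset.Icc 1 (k + 1), rowEll P.entry (k + 1) i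
          - ∑ i ∈ Finset.Icc 1 (k - 1), rowEll P.entry (k - 1) i - 1
        = P.weight k - P.weight (k + 1) := by
      rw [sum_rowEll, sum_rowEll, sum_rowEll]
      simp only [Pattern.weight, Pattern.rowSum, Nat.add_sub_cancel]
      obtain ⟨m, rfl⟩ : ∃ m, k = m + 1 := ⟨k - 1, by omega⟩
      rw [Nat.add_sub_cancel]
      have a : ∑ i ∈ Finset.Icc 1 (m + 1 + 1), ((i : ℝ) - 1)
          = ∑ i ∈ Finset.Icc 1 (m + 1), ((i : ℝ) - 1) + (m + 1) := by
        rw [Finset.sum_Icc_succ_top (by omega)]; push_cast; ring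
      have b : ∑ i ∈ Finset.Icc 1 (m + 1), ((i : ℝ) - 1)
          = ∑ i ∈ Finset.Icc 1 m, ((i : ℝ) - 1) + m := by
        rw [Finset.sum_Icc_succ_top (by omega)]; push_cast; ring
      rw [a, b]; ring
    rw [← e1, ← key]
    congr 1
    · refine Finset.sum_congr rfl fun i hi => ?_
      have hi' := Finset.mem_Icc.1 hi
      split_ifs with h
      · rw [rowRaise, rowLower, rowEll_bump_self]
        congr 2
        · exact Finset.prod_congr rfl fun p _ => by rw [rowEll_bump_of_ne _ _ (by omega)]
        · exact Finset.prod_congr rfl fun p hp => by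
            rw [rowEll_bump_of_ne _ _ (by simp at hp; tauto)]
      · -- a forbidden shift corresponds to a zero of the numerator
        have : P.entry (k + 1) i = P.entry k i ∨
            (2 ≤ i ∧ P.entry (k - 1) (i - 1) = P.entry k i) := by
          by_contra hcon
          push Not at hcon
          refine h (hP.raise_one hi'.1 hi'.2 hkr
            (lt_of_le_of_ne (hP.le_up hi'.1 hi'.2 hkr) (Ne.symm hcon.1)) fun h2 => ?_)
          have h3 := hP.up_le (j := k - 1) (i := i - 1) (by omega) (by omega) (by omega)
          rw [show k - 1 + 1 = k by omega, show i - 1 + 1 = i by omega] at h3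
          exact lt_of_le_of_ne h3 (Ne.symm (hcon.2 h2))
        rcases this with h0 | ⟨h2, h0⟩
        · rw [Finset.prod_eq_zero (i := i) (s := Finset.Icc 1 (k + 1)) (by simp; omega)
            (by simp only [rowEll]; rw [h0]; ring), zero_div, zero_mul]
        · rw [Finset.prod_eq_zero (i := i - 1) (s := Finset.Icc 1 (k - 1)) (by simp; omega)
            (by simp only [rowEll]; rw [h0, Nat.cast_sub (by omega)]; push_cast; ring),
            zero_div, mul_zero]
    · refine Finset.sum_congr rfl fun i hi => ?_
      have hi' := Finset.mem_Icc.1 hi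
      split_ifs with h
      · rw [rowRaise, rowLower, rowEll_bump_self]
        simp only [← sub_eq_add_neg]
        congr 2
        · exact Finset.prod_congr rfl fun p _ => by rw [rowEll_bump_of_ne _ _ (by omega)]
        · exact Finset.prod_congr rfl fun p hp => by
            rw [rowEll_bump_of_ne _ _ (by simp at hp; tauto)]
      · have : P.entry (k + 1) (i + 1) = P.entry k i ∨
            (i + 1 ≤ k ∧ P.entry (k - 1) i = P.entry k i) := by
          by_contra hcon
          push Not at hcon
          refine h (hP.lower_one hi'.1 hi'.2 hkr
            (lt_of_le_of_ne (hP.up_le hi'.1 hi'.2 hkr) hcon.1) fun h2 => ?_)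
          have h3 := hP.le_up (j := k - 1) (i := i) (by omega) (by omega) (by omega)
          rw [show k - 1 + 1 = k by omega] at h3
          exact lt_of_le_of_ne h3 (hcon.2 h2)
        rcases this with h0 | ⟨h2, h0⟩
        · rw [Finset.prod_eq_zero (i := i + 1) (s := Finset.Icc 1 (k + 1)) (by simp; omega)
            (by simp only [rowEll]; rw [h0]; push_cast; ring), zero_div, mul_zero]
        · rw [Finset.prod_eq_zero (i := i) (s := Finset.Icc 1 (k - 1)) (by simp; omega)
            (by simp only [rowEll]; rw [h0]; ring), zero_div, zero_mul]
  · intro p hp hpk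
    have h1 := hP.le_up (j := k) (i := p + 1) (by omega) hpk hkr
    have h2 := hP.up_le (j := k) (i := p) hp (by omega) hkr
    simp only [rowEll]
    push_cast
    constructor <;> linarith
  · intro p hp hpk
    have h1 := hP.le_up (j := k - 1) (i := p) (by omega) (by omega) (by omega)
    have h2 := hP.up_le (j := k - 1) (i := p) hp (by omega) (by omega)
    rw [show k - 1 + 1 = k by omega] at h1 h2
    simp only [rowEll]
    push_cast
    constructor <;> linarith

end Coefficients

lemma extendZero_entry {r : ℕ} {lam : Fin (r + 1) → ℝ} {M : Type*} [AddCommGroup M]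
    (ξ : Pattern lam → M) (P : Pattern lam) : extendZero ξ P.entry = ξ P := by
  rw [extendZero, dif_pos P.isPattern]

lemma extendZero_of_not {r : ℕ} {lam : Fin (r + 1) → ℝ} {M : Type*} [AddCommGroup M]
    (ξ : Pattern lam → M) {f : ℕ → ℕ → ℝ} (h : ¬ IsPattern lam f) :
    extendZero ξ f = 0 := by
  rw [extendZero, dif_neg h]

section Operators

variable {r : ℕ} {lam : Fin (r + 1) → ℝ} {M : Type*} [AddCommGroup M] [Module ℂ M]
  (ξ : Module.Basis (Pattern lam) ℂ M)

/-- The operator given by the formula for `E_{k,k+1}` on a Gelfand–Tsetlin basis. -/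
def raiseOp (k : ℕ) : Module.End ℂ M :=
  ξ.constr ℂ fun P => -∑ i ∈ Finset.Icc 1 k, (raiseCoeff P k i : ℂ) • extendZero ξ (shift P k i 1)

/-- The operator given by the formula for `E_{k+1,k}` on a Gelfand–Tsetlin basis. -/
def lowerOp (k : ℕ) : Module.End ℂ M :=
  ξ.constr ℂ fun P => ∑ i ∈ Finset.Icc 1 k, (lowerCoeff P k i : ℂ) • extendZero ξ (shift P k i (-1))

/-- The operator given by the formula for `E_{k,k} - E_{k+1,k+1}` on a Gelfand–Tsetlin basis. -/
def cartanOp (k : ℕ) : Module.End ℂ M :=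
  ξ.constr ℂ fun P => ((P.weight k - P.weight (k + 1) : ℝ) : ℂ) • ξ P

lemma raiseOp_basis (k : ℕ) (P : Pattern lam) : raiseOp ξ k (ξ P) =
    -∑ i ∈ Finset.Icc 1 k, (raiseCoeff P k i : ℂ) • extendZero ξ (shift P k i 1) := by
  rw [raiseOp, Module.Basis.constr_basis]

lemma lowerOp_basis (k : ℕ) (P : Pattern lam) : lowerOp ξ k (ξ P) =
    ∑ i ∈ Finset.Icc 1 k, (lowerCoeff P k i : ℂ) • extendZero ξ (shift P k i (-1)) := by
  rw [lowerOp, Module.Basis.constr_basis]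

lemma cartanOp_basis (k : ℕ) (P : Pattern lam) : cartanOp ξ k (ξ P) =
    ((P.weight k - P.weight (k + 1) : ℝ) : ℂ) • ξ P := by
  rw [cartanOp, Module.Basis.constr_basis]

open Classical in
lemma raiseOp_extendZero (k : ℕ) (f : ℕ → ℕ → ℝ) : raiseOp ξ k (extendZero ξ f) =
    if IsPattern lam f then
      -∑ i ∈ Finset.Icc 1 k, (rowRaise f k i : ℂ) • extendZero ξ (bump f k i 1) else 0 := by
  split_ifs with h
  · exact (congrArg _ (extendZero_entry ξ ⟨f, h⟩)).trans (raiseOp_basis ξ k ⟨f, h⟩)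
  · rw [extendZero_of_not _ h, map_zero]

open Classical in
lemma lowerOp_extendZero (k : ℕ) (f : ℕ → ℕ → ℝ) : lowerOp ξ k (extendZero ξ f) =
    if IsPattern lam f then
      ∑ i ∈ Finset.Icc 1 k, (rowLower f k i : ℂ) • extendZero ξ (bump f k i (-1)) else 0 := by
  split_ifs with h
  · exact (congrArg _ (extendZero_entry ξ ⟨f, h⟩)).trans (lowerOp_basis ξ k ⟨f, h⟩)
  · rw [extendZero_of_not _ h, map_zero]

open Classical in
/-- The two-step paths from `P` in `E_{k,k+1} E_{l+1,l}` and in `E_{l+1,l} E_{k,k+1}` that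
change two different entries have equal coefficients. -/
lemma path_coeff_eq (P : Pattern lam) {k l i j : ℕ} (hk : 1 ≤ j ∧ j ≤ k ∧ k ≤ r)
    (hl : 1 ≤ i ∧ i ≤ l ∧ l ≤ r) (hne : ¬ (l = k ∧ i = j)) :
    (if IsPattern lam (bump P.entry l i (-1)) then
      ((rowLower P.entry l i * rowRaise (bump P.entry l i (-1)) k j : ℝ) : ℂ) •
        extendZero ξ (bump (bump P.entry l i (-1)) k j 1) else 0) =
    if IsPattern lam (bump P.entry k j 1) then
      ((rowRaise P.entry k j * rowLower (bump P.entry k j 1) l i : ℝ) : ℂ) •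
        extendZero ξ (bump (bump P.entry k j 1) l i (-1)) else 0 := by
  rw [bump_comm P.entry k j l i, rowLower_mul_rowRaise P.entry ⟨hk.1, hk.2.1⟩ ⟨hl.1, hl.2.1⟩ hne]
  by_cases h : IsPattern lam (bump (bump P.entry l i (-1)) k j 1)
  · obtain ⟨h1, h2⟩ := P.isPattern.of_bump_bump hl hk hne h
    rw [if_pos h1, if_pos h2]
  · rw [extendZero_of_not _ h, smul_zero, ite_self, ite_self]

open Classical in
lemma raiseOp_lowerOp (k l : ℕ) (P : Pattern lam) :
    raiseOp ξ k (lowerOp ξ l (ξ P)) = -∑ i ∈ Finset.Icc 1 l, ∑ j ∈ Finset.Icc 1 k,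
      if IsPattern lam (bump P.entry l i (-1)) then
      ((rowLower P.entry l i * rowRaise (bump P.entry l i (-1)) k j : ℝ) : ℂ) •
        extendZero ξ (bump (bump P.entry l i (-1)) k j 1) else 0 := by
  rw [lowerOp_basis, map_sum, ← Finset.sum_neg_distrib]
  refine Finset.sum_congr rfl fun i _ => ?_
  rw [map_smul, shift_eq_bump, raiseOp_extendZero, lowerCoeff_eq]
  split_ifs
  · rw [smul_neg, Finset.smul_sum]
    simp only [smul_smul, Complex.ofReal_mul]
  · simp

open Classical in
lemma lowerOp_raiseOp (k l : ℕ) (P : Pattern lam) :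
    lowerOp ξ l (raiseOp ξ k (ξ P)) = -∑ i ∈ Finset.Icc 1 l, ∑ j ∈ Finset.Icc 1 k,
      if IsPattern lam (bump P.entry k j 1) then
      ((rowRaise P.entry k j * rowLower (bump P.entry k j 1) l i : ℝ) : ℂ) •
        extendZero ξ (bump (bump P.entry k j 1) l i (-1)) else 0 := by
  rw [raiseOp_basis, map_neg, map_sum, Finset.sum_comm]
  refine congrArg _ (Finset.sum_congr rfl fun i _ => ?_)
  rw [map_smul, shift_eq_bump, lowerOp_extendZero, raiseCoeff_eq]
  split_ifs
  · rw [Finset.smul_sum]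
    simp only [smul_smul, Complex.ofReal_mul]
  · simp

lemma raiseOp_lowerOp_of_ne {k l : ℕ} (hk : k ≤ r) (hl : l ≤ r) (hkl : k ≠ l) :
    raiseOp ξ k * lowerOp ξ l = lowerOp ξ l * raiseOp ξ k := by
  refine ξ.ext fun P => ?_
  rw [Module.End.mul_apply, Module.End.mul_apply, raiseOp_lowerOp, lowerOp_raiseOp]
  refine congrArg _ (Finset.sum_congr rfl fun i hi => Finset.sum_congr rfl fun j hj => ?_)
  rw [Finset.mem_Icc] at hi hj
  exact path_coeff_eq ξ P ⟨hj.1, hj.2, hk⟩ ⟨hi.1, hi.2, hl⟩ (by omega)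

open Classical in
lemma raiseOp_lowerOp_self {k : ℕ} (hk : 1 ≤ k) (hkr : k ≤ r) :
    raiseOp ξ k * lowerOp ξ k = lowerOp ξ k * raiseOp ξ k + cartanOp ξ k := by
  refine ξ.ext fun P => ?_
  rw [LinearMap.add_apply, Module.End.mul_apply, Module.End.mul_apply, raiseOp_lowerOp,
    lowerOp_raiseOp, cartanOp_basis, ← diagonal_commutator_coeff P hk hkr, ← sub_eq_iff_eq_add',
    sub_neg_eq_add, neg_add_eq_sub, ← Finset.sum_sub_distrib]
  push_cast
  rw [sub_smul, Finset.sum_smul, Finset.sum_smul, ← Finset.sum_sub_distrib]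
  refine Finset.sum_congr rfl fun i hi => ?_
  rw [← Finset.sum_sub_distrib, Finset.sum_eq_single_of_mem i hi]
  · rw [bump_bump_neg _ _ _ _ _ (by ring), bump_bump_neg _ _ _ _ _ (by ring), extendZero_entry]
    split_ifs <;> simp
  · intro j hj hji
    rw [Finset.mem_Icc] at hi hj
    have h := path_coeff_eq ξ P ⟨hj.1, hj.2, hkr⟩ ⟨hi.1, hi.2, hkr⟩ (fun h => hji h.2.symm)
    push_cast at h
    rw [sub_eq_zero, h]

/-- The negatives of the entries of the Cartan matrix of `sl_{r+1}`. -/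
def negCartan (k l : ℕ) : ℂ :=
  (if k = l then -2 else 0) + (if k = l + 1 then 1 else 0) + (if k + 1 = l then 1 else 0)

lemma sum_bump (f : ℕ → ℕ → ℝ) {k i : ℕ} (hi : i ∈ Finset.Icc 1 k) (c : ℝ) (m : ℕ) :
    ∑ p ∈ Finset.Icc 1 m, bump f k i c m p
      = ∑ p ∈ Finset.Icc 1 m, f m p + if m = k then c else 0 := by
  split_ifs with h
  · subst h
    rw [← Finset.add_sum_erase _ _ hi, ← Finset.add_sum_erase _ (f m) hi, bump_self,
      Finset.sum_congr (g := f m) rfl fun p hp => bump_of_ne _ _ (by simp at hp; tauto)]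
    ring
  · rw [add_zero]
    exact Finset.sum_congr rfl fun p _ => bump_of_ne _ _ (by tauto)

lemma cartanOp_lowerOp {k l : ℕ} (hk : 1 ≤ k) (hl : 1 ≤ l) :
    cartanOp ξ k * lowerOp ξ l = lowerOp ξ l * cartanOp ξ k + negCartan k l • lowerOp ξ l := by
  refine ξ.ext fun P => ?_
  rw [LinearMap.add_apply, Module.End.mul_apply, Module.End.mul_apply, cartanOp_basis, map_smul,
    LinearMap.smul_apply, ← add_smul, lowerOp_basis, map_sum, Finset.smul_sum]
  refine Finset.sum_congr rfl fun i hi => ?_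
  rw [map_smul, smul_comm (_ + _)]
  congr 1
  rw [shift_eq_bump]
  by_cases h : IsPattern lam (bump P.entry l i (-1))
  · have e : extendZero ξ (bump P.entry l i (-1)) = ξ ⟨_, h⟩ := extendZero_entry ξ ⟨_, h⟩
    rw [e, cartanOp_basis]
    congr 1
    simp only [Pattern.weight, Pattern.rowSum, sum_bump _ hi, negCartan, Nat.add_sub_cancel]
    have : (k - 1 = l) = (k = l + 1) := by rw [eq_iff_iff]; omega
    simp only [this]
    push_cast
    split_ifs <;> first | omega | (push_cast; ring)
  · rw [extendZero_of_not _ h]; simp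

end Operators

/-! ### Singular vectors -/

section Singular

variable {r : ℕ} {lam : Fin (r + 1) → ℝ}

instance fintypePattern : Fintype (Pattern lam) := Fintype.ofFinite _

lemma pos_val {r k : ℕ} (hk : 1 ≤ k) (hkr : k ≤ r + 1) : (pos r k).val = k - 1 := by
  simp only [pos, Fin.val_ofNat]
  exact Nat.mod_eq_of_lt (by omega)

lemma bounding_pos (P : Pattern lam) {i : ℕ} (hi : 1 ≤ i) (hir : i ≤ r + 1) :
    P.entry (r + 1) i = lam (pos r i) := by
  rw [← P.isPattern.bounding, pos_val hi hir, Nat.sub_add_cancel hi]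

/-- The pattern of weight `lam`: every row is an initial segment of `lam`. -/
def topPattern (hlam : IsDominantIntegral lam) : Pattern lam where
  entry j i := if 1 ≤ i ∧ i ≤ j ∧ j ≤ r + 1 then lam (pos r i) else 0
  isPattern :=
    { outside := fun j i h => if_neg h
      bounding := fun i => by
        rw [if_pos (by omega)]
        congr 1
        ext
        rw [pos_val (by omega) (by omega), Nat.add_sub_cancel]
      upper := fun j i hi hij hj => ⟨0, by
        rw [if_pos (by omega), if_pos (by omega)]; simp⟩
      lower := fun j i hi hij hj => by
        rw [if_pos (by omega), if_pos (by omega)]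
        obtain ⟨n, hn⟩ := hlam ⟨i - 1, by omega⟩
        refine ⟨n, ?_⟩
        rw [← hn]
        congr 2 <;> ext <;> rw [pos_val (by omega) (by omega)]
        · rfl
        · simp; omega }

lemma topPattern_entry (hlam : IsDominantIntegral lam) {j i : ℕ} (hi : 1 ≤ i) (hij : i ≤ j)
    (hj : j ≤ r + 1) : (topPattern hlam).entry j i = lam (pos r i) :=
  if_pos ⟨hi, hij, hj⟩

lemma eq_topPattern (hlam : IsDominantIntegral lam) (P : Pattern lam)
    (h : ∀ j i, 1 ≤ i → i ≤ j → j ≤ r → P.entry j i = P.entry (j + 1) i) : P = topPattern hlam := by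
  have key : ∀ n j i, 1 ≤ i → i ≤ j → j + n = r + 1 → P.entry j i = lam (pos r i) := by
    intro n
    induction n with
    | zero =>
      intro j i hi hij hj
      rw [add_zero] at hj
      subst hj
      exact bounding_pos P hi hij
    | succ n ih =>
      intro j i hi hij hj
      rw [h j i hi hij (by omega), ih (j + 1) i hi (by omega) (by omega)]
  ext j i
  by_cases hji : 1 ≤ i ∧ i ≤ j ∧ j ≤ r + 1
  · rw [key (r + 1 - j) j i hji.1 hji.2.1 (by omega), topPattern_entry hlam hji.1 hji.2.1 hji.2.2]
  · rw [P.isPattern.outside j i hji, (topPattern hlam).isPattern.outside j i hji]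

variable {M : Type*} [AddCommGroup M] [Module ℂ M] (ξ : Module.Basis (Pattern lam) ℂ M)

lemma repr_apply (T : Module.End ℂ M) (x : M) (Q : Pattern lam) :
    ξ.repr (T x) Q = ∑ P, ξ.repr x P * ξ.repr (T (ξ P)) Q := by
  conv_lhs => rw [← ξ.sum_repr x]
  simp only [map_sum, map_smul, Finsupp.coe_finsetSum, Finset.sum_apply, Finsupp.smul_apply,
    smul_eq_mul]

open Classical in
lemma repr_extendZero (f : ℕ → ℕ → ℝ) (Q : Pattern lam) :
    ξ.repr (extendZero ξ f) Q = if f = Q.entry then 1 else 0 := by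
  split_ifs with h
  · rw [h, extendZero_entry]; simp
  · by_cases hf : IsPattern lam f
    · rw [show f = (⟨f, hf⟩ : Pattern lam).entry from rfl, extendZero_entry,
        Module.Basis.repr_self, Finsupp.single_apply, if_neg]
      rintro rfl
      exact h rfl
    · rw [extendZero_of_not _ hf]; simp

open Classical in
lemma repr_raiseOp (k : ℕ) (P Q : Pattern lam) : ξ.repr (raiseOp ξ k (ξ P)) Q =
    -∑ i ∈ Finset.Icc 1 k, if bump P.entry k i 1 = Q.entry then (raiseCoeff P k i : ℂ) else 0 := by
  rw [raiseOp_basis]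
  simp only [map_neg, map_sum, map_smul, Finsupp.coe_neg, Finsupp.coe_finsetSum, Pi.neg_apply,
    Finset.sum_apply, Finsupp.smul_apply, repr_extendZero, shift_eq_bump, smul_eq_mul, mul_ite,
    mul_one, mul_zero]

lemma exists_of_repr_raiseOp_ne_zero {k : ℕ} {P Q : Pattern lam}
    (h : ξ.repr (raiseOp ξ k (ξ P)) Q ≠ 0) :
    ∃ i ∈ Finset.Icc 1 k, bump P.entry k i 1 = Q.entry := by
  classical
  by_contra hcon
  push Not at hcon
  rw [repr_raiseOp, neg_ne_zero] at h
  exact h (Finset.sum_eq_zero fun i hi => if_neg (hcon i hi))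

/-- In a vector killed by all the `E_{k,k+1}`, only patterns with `λ^j_i = λ^{j+1}_i` occur. If
row `k` is the lowest one where this fails, at the position `i` chosen minimal, then
`ξ_{P + δ^k_i}` gets a contribution from `ξ_P` only. -/
lemma entry_eq_of_singular {x : M} (hx : ∀ k, 1 ≤ k → k ≤ r → raiseOp ξ k x = 0)
    (k : ℕ) (hk : k ≤ r + 1) (P : Pattern lam) (hP : ξ.repr x P ≠ 0) (j i : ℕ) (hi : 1 ≤ i)
    (hij : i ≤ j) (hjk : j < k) : P.entry j i = P.entry (j + 1) i := by
  classical
  induction k generalizing P j i with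
  | zero => omega
  | succ k ih =>
    have ih' := fun P hP j i hi hij hjk => ih (by omega) P hP j i hi hij hjk
    by_cases hjk' : j < k
    · exact ih' P hP j i hi hij hjk'
    obtain rfl : j = k := by omega
    by_contra hne
    -- the smallest position where rows `j` and `j + 1` differ
    have hex : ∃ i, 1 ≤ i ∧ i ≤ j ∧ P.entry j i ≠ P.entry (j + 1) i := ⟨i, hi, hij, hne⟩
    obtain ⟨hs1, hsj, hsne⟩ := Nat.find_spec hex
    have hmin := fun m hm => Nat.find_min hex (m := m) hm
    set s := Nat.find hex
    have hPs := P.isPattern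
    have hlt : P.entry j s < P.entry (j + 1) s :=
      lt_of_le_of_ne (hPs.le_up hs1 hsj (by omega)) hsne
    have hQ : IsPattern lam (bump P.entry j s 1) := by
      refine hPs.raise_one hs1 hsj (by omega) hlt fun h2 => ?_
      have e1 : P.entry j (s - 1) = P.entry (j + 1) (s - 1) := by
        by_contra h
        exact hmin (s - 1) (by omega) ⟨by omega, by omega, h⟩
      have e2 := ih' P hP (j - 1) (s - 1) (by omega) (by omega) (by omega)
      rw [show j - 1 + 1 = j by omega] at e2
      have e3 := hPs.succ_le (j := j + 1) (i := s - 1) (by omega) (by omega) (by omega)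
      rw [show s - 1 + 1 = s by omega] at e3
      linarith
    have h0 := congrArg (fun y => ξ.repr y ⟨_, hQ⟩) (hx j (by omega) (by omega))
    simp only [map_zero, Finsupp.coe_zero, Pi.zero_apply] at h0
    have uniq : ∀ P', ξ.repr x P' ≠ 0 → ∀ i ∈ Finset.Icc 1 j,
        bump P'.entry j i 1 = bump P.entry j s 1 → P' = P ∧ i = s := by
      intro P' hP' i hi e
      rw [Finset.mem_Icc] at hi
      have his : i = s := by
        by_contra his
        have a : ∀ p, P'.entry (j - 1) p = P.entry (j - 1) p := fun p => by
          have := congrFun (congrFun e (j - 1)) p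
          rwa [bump_of_ne _ _ (by omega), bump_of_ne _ _ (by omega)] at this
        have b := congrFun (congrFun e j) s
        rw [bump_self, bump_of_ne _ _ (by tauto)] at b
        have c := congrFun (congrFun e j) i
        rw [bump_self, bump_of_ne _ _ (by tauto)] at c
        by_cases hsj' : s ≤ j - 1
        · have u := ih' P hP (j - 1) s hs1 hsj' (by omega)
          have v := ih' P' hP' (j - 1) s hs1 hsj' (by omega)
          rw [show j - 1 + 1 = j by omega] at u v
          linarith [a s]
        · have u := ih' P hP (j - 1) i hi.1 (by omega) (by omega)
          have v := ih' P' hP' (j - 1) i hi.1 (by omega) (by omega)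
          rw [show j - 1 + 1 = j by omega] at u v
          linarith [a i]
      subst his
      refine ⟨Pattern.ext ?_, rfl⟩
      rw [← bump_bump_neg P'.entry j s 1 (-1) (by ring), e, bump_bump_neg _ _ _ _ _ (by ring)]
    rw [repr_apply, Finset.sum_eq_single P] at h0
    · rw [repr_raiseOp, mul_eq_zero, or_iff_right hP, neg_eq_zero,
        Finset.sum_eq_single_of_mem s (Finset.mem_Icc.2 ⟨hs1, hsj⟩), if_pos rfl,
        Complex.ofReal_eq_zero, raiseCoeff_eq, rowRaise, div_eq_zero_iff] at h0
      · have mono : ∀ p q, 1 ≤ p → p < q → q ≤ j + 1 →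
            rowEll P.entry (j + 1) q < rowEll P.entry (j + 1) p := by
          intro p q hp hpq hq
          have := hPs.antitone hp hpq.le hq (by omega)
          have h' : (p : ℝ) < q := by exact_mod_cast hpq
          simp only [rowEll]; linarith
        have hb : rowEll P.entry j s < rowEll P.entry (j + 1) s := by
          simp only [rowEll]; linarith
        rcases h0 with h0 | h0
        · rw [Finset.prod_eq_zero_iff] at h0
          obtain ⟨p, hp, h0⟩ := h0
          rw [Finset.mem_Icc] at hp
          rw [sub_eq_zero] at h0
          rcases lt_trichotomy p s with h | h | h
          · have := mono p s hp.1 h (by omega)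
            linarith
          · subst h; linarith
          · have h1 := hPs.antitone (j := j + 1) (i := s + 1) (p := p) (by omega) (by omega)
              hp.2 (by omega)
            have h2 := hPs.up_le (j := j) hs1 hsj (by omega)
            have h' : (s : ℝ) < p := by exact_mod_cast h
            simp only [rowEll] at h0
            linarith
        · rw [Finset.prod_eq_zero_iff] at h0
          obtain ⟨p, hp, h0⟩ := h0
          rw [Finset.mem_erase, Finset.mem_Icc] at hp
          rw [sub_eq_zero] at h0
          simp only [rowEll] at h0
          rcases lt_or_gt_of_ne hp.1 with h | h
          · have h1 := hPs.antitone (j := j) hp.2.1 h.le hsj (by omega)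
            have h' : (p : ℝ) < s := by exact_mod_cast h
            linarith
          · have h1 := hPs.antitone (j := j) hs1 h.le hp.2.2 (by omega)
            have h' : (s : ℝ) < p := by exact_mod_cast h
            linarith
      · intro i hi his
        exact if_neg fun h => his (uniq P hP i hi h).2
    · intro P' _ hP'
      by_cases hz : ξ.repr x P' = 0
      · rw [hz, zero_mul]
      · rw [repr_raiseOp, Finset.sum_eq_zero fun i hi => if_neg fun h => hP' (uniq P' hz i hi h).1,
          neg_zero, mul_zero]
    · simp

lemma eq_smul_of_singular (hlam : IsDominantIntegral lam) {x : M}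
    (hx : ∀ k, 1 ≤ k → k ≤ r → raiseOp ξ k x = 0) :
    x = ξ.repr x (topPattern hlam) • ξ (topPattern hlam) := by
  conv_lhs => rw [← ξ.sum_repr x]
  refine Finset.sum_eq_single _ (fun P _ hP => ?_) (by simp)
  by_cases h : ξ.repr x P = 0
  · rw [h, zero_smul]
  · exact absurd (eq_topPattern hlam P fun j i hi hij hj =>
      entry_eq_of_singular ξ hx (r + 1) le_rfl P h j i hi hij (by omega)) hP

/-- The sum of all entries of a pattern. -/
def total (P : Pattern lam) : ℝ := ∑ j ∈ Finset.Icc 1 r, ∑ i ∈ Finset.Icc 1 j, P.entry j i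

/-- A non-zero subspace stable under all the `E_{k,k+1}` contains the highest weight vector:
repeated raising has to end in a vector killed by all the `E_{k,k+1}`. -/
lemma basis_top_mem_of_stable (hlam : IsDominantIntegral lam) (K : Submodule ℂ M)
    (hK : ∀ k, 1 ≤ k → k ≤ r → ∀ x ∈ K, raiseOp ξ k x ∈ K) (hne : K ≠ ⊥) :
    ξ (topPattern hlam) ∈ K := by
  obtain ⟨B, hB⟩ := (Set.finite_range (total (lam := lam))).bddAbove
  obtain ⟨A, hA⟩ := (Set.finite_range (total (lam := lam))).bddBelow
  have hB' : ∀ P : Pattern lam, total P ≤ B := fun P => hB ⟨P, rfl⟩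
  have hA' : ∀ P : Pattern lam, A ≤ total P := fun P => hA ⟨P, rfl⟩
  have key : ∀ n : ℕ, ∀ x ∈ K, x ≠ 0 → (∀ P, ξ.repr x P ≠ 0 → B - n < total P) →
      ξ (topPattern hlam) ∈ K := by
    intro n
    induction n with
    | zero =>
      intro x _ hx hsupp
      obtain ⟨P, hP⟩ : ∃ P, ξ.repr x P ≠ 0 := by
        by_contra h
        push Not at h
        exact hx (ξ.repr.map_eq_zero_iff.1 (Finsupp.ext h))
      have := hsupp P hP
      push_cast at this
      linarith [hB' P]
    | succ n ih =>
      intro x hxK hx hsupp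
      by_cases hs : ∀ k, 1 ≤ k → k ≤ r → raiseOp ξ k x = 0
      · have e := eq_smul_of_singular ξ hlam hs
        have hc : ξ.repr x (topPattern hlam) ≠ 0 := fun h => hx (by rw [e, h, zero_smul])
        rw [e] at hxK
        exact (K.smul_mem_iff hc).1 hxK
      · push Not at hs
        obtain ⟨k, hk, hkr, hne⟩ := hs
        refine ih _ (hK k hk hkr x hxK) hne fun Q hQ => ?_
        rw [repr_apply] at hQ
        obtain ⟨P, _, hP⟩ := Finset.exists_ne_zero_of_sum_ne_zero hQ
        have h1 := hsupp P (left_ne_zero_of_mul hP)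
        obtain ⟨i, hi, e⟩ := exists_of_repr_raiseOp_ne_zero ξ (right_ne_zero_of_mul hP)
        have : total Q = total P + 1 := by
          rw [total, ← e, total]
          simp only [sum_bump _ hi, Finset.sum_add_distrib]
          rw [Finset.sum_ite_eq' (Finset.Icc 1 r), if_pos (Finset.mem_Icc.2 ⟨hk, hkr⟩)]
        push_cast at h1
        linarith
  obtain ⟨x, hxK, hx⟩ := K.exists_mem_ne_zero_of_ne_bot hne
  obtain ⟨n, hn⟩ := exists_nat_gt (B - A)
  exact key n x hxK hx fun P _ => by linarith [hA' P]

end Singular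

/-! ### Operators that lower patterns -/

section Drop

variable {r : ℕ} {lam : Fin (r + 1) → ℝ}

/-- `Q` is entrywise at most `P`, and the sum of row `m` is smaller by `d m`. -/
structure Drop (d : ℕ → ℝ) (P Q : Pattern lam) : Prop where
  le : ∀ j i, Q.entry j i ≤ P.entry j i
  rowSum : ∀ m, Q.rowSum m = P.rowSum m - d m

lemma Pattern.ext_of_range {P Q : Pattern lam}
    (h : ∀ j i, 1 ≤ i → i ≤ j → j ≤ r + 1 → P.entry j i = Q.entry j i) : P = Q := by
  ext j i
  by_cases hji : 1 ≤ i ∧ i ≤ j ∧ j ≤ r + 1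
  · exact h j i hji.1 hji.2.1 hji.2.2
  · rw [P.isPattern.outside j i hji, Q.isPattern.outside j i hji]

lemma eq_of_le_of_sum_eq {a b : ℕ → ℝ} {m : ℕ} (h : ∀ i, 1 ≤ i → i ≤ m → a i ≤ b i)
    (hs : ∑ i ∈ Finset.Icc 1 m, b i ≤ ∑ i ∈ Finset.Icc 1 m, a i) {i : ℕ} (hi : 1 ≤ i)
    (him : i ≤ m) : a i = b i := by
  have h' : ∀ i ∈ Finset.Icc 1 m, a i ≤ b i := fun i hi =>
    h i (Finset.mem_Icc.1 hi).1 (Finset.mem_Icc.1 hi).2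
  exact (Finset.sum_eq_sum_iff_of_le h').1 (le_antisymm (Finset.sum_le_sum h') hs) i
    (Finset.mem_Icc.2 ⟨hi, him⟩)

lemma Drop.row_eq {d : ℕ → ℝ} {P Q : Pattern lam} (h : Drop d P Q) {m : ℕ} (hm : d m = 0) {i : ℕ}
    (hi : 1 ≤ i) (him : i ≤ m) : Q.entry m i = P.entry m i := by
  have hs := h.rowSum m
  rw [hm, sub_zero] at hs
  exact eq_of_le_of_sum_eq (fun i _ _ => h.le m i) hs.ge hi him

variable {M : Type*} [AddCommGroup M] [Module ℂ M] (ξ : Module.Basis (Pattern lam) ℂ M)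

/-- The operator `T` lowers the patterns of the basis vectors by the row sums `d`. -/
def Drops (d : ℕ → ℝ) (T : Module.End ℂ M) : Prop :=
  ∀ P Q, ξ.repr (T (ξ P)) Q ≠ 0 → Drop d P Q

variable {ξ}

lemma Drops.one : Drops ξ 0 (1 : Module.End ℂ M) := by
  intro P Q h
  rw [Module.End.one_apply, Module.Basis.repr_self] at h
  obtain rfl : P = Q := by
    by_contra hPQ
    exact h (Finsupp.single_eq_of_ne' hPQ)
  exact ⟨fun _ _ => le_rfl, fun m => by simp⟩

lemma Drops.mul {d e : ℕ → ℝ} {S T : Module.End ℂ M} (hS : Drops ξ d S) (hT : Drops ξ e T) :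
    Drops ξ (d + e) (S * T) := by
  intro P Q h
  rw [Module.End.mul_apply, repr_apply] at h
  obtain ⟨R, _, hR⟩ := Finset.exists_ne_zero_of_sum_ne_zero h
  have h1 := hT P R (left_ne_zero_of_mul hR)
  have h2 := hS R Q (right_ne_zero_of_mul hR)
  exact ⟨fun j i => (h2.le j i).trans (h1.le j i), fun m => by
    rw [h2.rowSum, h1.rowSum, Pi.add_apply]; ring⟩

lemma Drops.sub {d : ℕ → ℝ} {S T : Module.End ℂ M} (hS : Drops ξ d S) (hT : Drops ξ d T) :
    Drops ξ d (S - T) := by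
  intro P Q h
  rw [LinearMap.sub_apply, map_sub, Finsupp.sub_apply] at h
  by_cases h1 : ξ.repr (S (ξ P)) Q = 0
  · exact hT P Q fun h2 => h (by rw [h1, h2, sub_zero])
  · exact hS P Q h1

lemma Drops.smul {d : ℕ → ℝ} {T : Module.End ℂ M} (c : ℂ) (hT : Drops ξ d T) :
    Drops ξ d (c • T) := by
  intro P Q h
  rw [LinearMap.smul_apply, map_smul, Finsupp.smul_apply, smul_eq_mul] at h
  exact hT P Q (right_ne_zero_of_mul h)

lemma Drops.pow {d : ℕ → ℝ} {T : Module.End ℂ M} (hT : Drops ξ d T) (n : ℕ) :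
    Drops ξ ((n : ℝ) • d) (T ^ n) := by
  induction n with
  | zero =>
    have e : ((0 : ℕ) : ℝ) • d = 0 := by rw [Nat.cast_zero, zero_smul]
    rw [pow_zero, e]
    exact Drops.one
  | succ n ih =>
    have e : ((n + 1 : ℕ) : ℝ) • d = (n : ℝ) • d + d := by
      rw [Nat.cast_succ, add_smul, one_smul]
    rw [pow_succ, e]
    exact ih.mul hT

lemma Drops.dividedPower {d : ℕ → ℝ} {T : Module.End ℂ M} (hT : Drops ξ d T) (n : ℕ) :
    Drops ξ ((n : ℝ) • d) (dividedPower T n) :=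
  (hT.pow n).smul _

/-- A matrix entry of a product to which a single intermediate pattern contributes. -/
lemma repr_mul_of_unique (S T : Module.End ℂ M) (P R Q : Pattern lam)
    (h : ∀ R', ξ.repr (T (ξ P)) R' ≠ 0 → ξ.repr (S (ξ R')) Q ≠ 0 → R' = R) :
    ξ.repr ((S * T) (ξ P)) Q = ξ.repr (T (ξ P)) R * ξ.repr (S (ξ R)) Q := by
  rw [Module.End.mul_apply, repr_apply]
  refine Finset.sum_eq_single R (fun R' _ hR' => ?_) (by simp)
  by_contra hne
  exact hR' (h R' (left_ne_zero_of_mul hne) (right_ne_zero_of_mul hne))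

variable (ξ)

/-- A family of operators `F p q`, for `q < p`, that satisfies the commutation relations of the
matrix units `E_{p,q}` and acts by the Gelfand–Tsetlin formulas if `p = q + 1`. -/
structure IsLowering (F : ℕ → ℕ → Module.End ℂ M) : Prop where
  simple : ∀ k, 1 ≤ k → k ≤ r → ∀ P : Pattern lam, F (k + 1) k (ξ P) =
    ∑ i ∈ Finset.Icc 1 k, (lowerCoeff P k i : ℂ) • extendZero ξ (shift P k i (-1))
  comm : ∀ j i, 1 ≤ i → i < j → j ≤ r →
    F (j + 1) i = F (j + 1) j * F j i - F j i * F (j + 1) j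

variable {ξ} {F : ℕ → ℕ → Module.End ℂ M}

open Classical in
lemma IsLowering.repr_simple (hF : IsLowering ξ F) {k : ℕ} (hk : 1 ≤ k) (hkr : k ≤ r)
    (P Q : Pattern lam) : ξ.repr (F (k + 1) k (ξ P)) Q =
    ∑ i ∈ Finset.Icc 1 k,
      if bump P.entry k i (-1) = Q.entry then (lowerCoeff P k i : ℂ) else 0 := by
  rw [hF.simple k hk hkr]
  simp only [map_sum, map_smul, Finsupp.coe_finsetSum,
    Finset.sum_apply, Finsupp.smul_apply, repr_extendZero, shift_eq_bump, smul_eq_mul, mul_ite,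
    mul_one, mul_zero]

lemma IsLowering.repr_simple_bump (hF : IsLowering ξ F) {k i : ℕ} (hi : 1 ≤ i) (hik : i ≤ k)
    (hkr : k ≤ r) (P Q : Pattern lam) (h : Q.entry = bump P.entry k i (-1)) :
    ξ.repr (F (k + 1) k (ξ P)) Q = (lowerCoeff P k i : ℂ) := by
  classical
  rw [hF.repr_simple (by omega) hkr, Finset.sum_eq_single_of_mem i (Finset.mem_Icc.2 ⟨hi, hik⟩),
    if_pos h.symm]
  intro i' _ hne
  rw [if_neg]
  intro h'
  exact hne (bump_injective (by norm_num) (h'.trans h))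

/-- The indicator function of the rows `i, …, j`. -/
def rowsBetween (i j m : ℕ) : ℝ := if i ≤ m ∧ m ≤ j then 1 else 0

lemma IsLowering.drops_simple (hF : IsLowering ξ F) {k : ℕ} (hk : 1 ≤ k) (hkr : k ≤ r) :
    Drops ξ (rowsBetween k k) (F (k + 1) k) := by
  classical
  intro P Q h
  rw [hF.repr_simple hk hkr] at h
  obtain ⟨i, hi, h⟩ := Finset.exists_ne_zero_of_sum_ne_zero h
  have e : bump P.entry k i (-1) = Q.entry := by
    by_contra hne
    exact h (if_neg hne)
  constructor
  · intro a b
    rw [← e, bump]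
    split_ifs <;> linarith
  · intro m
    rw [Pattern.rowSum, ← e, sum_bump _ hi, Pattern.rowSum, rowsBetween]
    by_cases hm : m = k
    · rw [if_pos hm, if_pos (by omega)]; ring
    · rw [if_neg hm, if_neg (by omega)]; ring

lemma IsLowering.drops (hF : IsLowering ξ F) {i j : ℕ} (hi : 1 ≤ i) (hij : i ≤ j) (hj : j ≤ r) :
    Drops ξ (rowsBetween i j) (F (j + 1) i) := by
  induction j, hij using Nat.le_induction with
  | base => exact hF.drops_simple hi hj
  | succ j hij ih =>
    have ih := ih (by omega)
    have h1 := hF.drops_simple (k := j + 1) (by omega) hj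
    have e : rowsBetween i (j + 1) = rowsBetween (j + 1) (j + 1) + rowsBetween i j := by
      ext m
      simp only [rowsBetween, Pi.add_apply]
      split_ifs <;> first | omega | norm_num
    rw [hF.comm (j + 1) i hi (by omega) hj]
    refine Drops.sub ?_ ?_
    · rw [e]; exact h1.mul ih
    · rw [e, add_comm]; exact ih.mul h1

/-- `f` with the entries in position `s` of the rows `s, …, m` lowered by one. -/
def lowerCol (f : ℕ → ℕ → ℝ) (s m : ℕ) : ℕ → ℕ → ℝ :=
  fun q i => if i = s ∧ s ≤ q ∧ q ≤ m then f q i - 1 else f q i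

lemma isPattern_lowerCol {T : Pattern lam} {s j m : ℕ} (hs : 1 ≤ s) (hj : j ≤ r) (hmj : m ≤ j)
    (h : IsPattern lam (lowerCol T.entry s j)) : IsPattern lam (lowerCol T.entry s m) := by
  refine T.isPattern.of_int (fun q i => ?_) (fun q i hqi => ?_) (fun q i hi hiq hq => ?_)
    (fun q i hi hiq hq => ?_)
  · simp only [lowerCol]
    split_ifs
    · exact ⟨-1, by push_cast; ring⟩
    · exact ⟨0, by simp⟩
  · exact if_neg (by omega)
  · have h1 := T.isPattern.le_up hi hiq hq
    simp only [lowerCol]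
    split_ifs <;> first | linarith | omega
  · have h1 := T.isPattern.up_le hi hiq hq
    have h2 := h.up_le hi hiq hq
    simp only [lowerCol] at h2 ⊢
    split_ifs at h2 ⊢ <;> first | linarith | omega

/-- The Gelfand–Tsetlin coefficient for lowering position `s` of row `m`, when the rows `m - 1` and
`m` coincide except that position `s` has already been lowered in row `m - 1`: nearly all factors
cancel. -/
lemma rowLower_of_rows_eq {f : ℕ → ℕ → ℝ} {c : ℕ → ℝ} {s m : ℕ} (hs : 1 ≤ s) (hsm : s ≤ m)
    (hrow : ∀ i, 1 ≤ i → i ≤ m → f m i = c i)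
    (hrow' : ∀ i, 1 ≤ i → i ≤ m - 1 → f (m - 1) i = if i = s then c i - 1 else c i)
    (hc : ∀ i, 1 ≤ i → i ≤ m → i ≠ s → c s - s - (c i - i) ≠ 0) :
    rowLower f m s = if s = m then 1 else (c s - s - (c m - m))⁻¹ := by
  have hden : ∀ p, 1 ≤ p → p ≤ m → rowEll f m s - rowEll f m p = c s - s - (c p - p) := by
    intro p hp hpm
    rw [rowEll, rowEll, hrow s hs hsm, hrow p hp hpm]
    ring
  have hnum : ∀ p, 1 ≤ p → p ≤ m - 1 → p ≠ s →
      rowEll f m s - rowEll f (m - 1) p = c s - s - (c p - p) := by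
    intro p hp hpm hps
    rw [rowEll, rowEll, hrow s hs hsm, hrow' p hp hpm, if_neg hps]
    ring
  rw [rowLower]
  split_ifs with h
  · subst h
    have e : (Finset.Icc 1 s).erase s = Finset.Icc 1 (s - 1) := by ext; simp; omega
    rw [e]
    have e2 : ∏ p ∈ Finset.Icc 1 (s - 1), (rowEll f s s - rowEll f (s - 1) p)
        = ∏ p ∈ Finset.Icc 1 (s - 1), (rowEll f s s - rowEll f s p) := by
      refine Finset.prod_congr rfl fun p hp => ?_
      rw [Finset.mem_Icc] at hp
      rw [hnum p hp.1 hp.2 (by omega), hden p hp.1 (by omega)]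
    rw [e2]
    refine div_self (Finset.prod_ne_zero_iff.2 fun p hp => ?_)
    rw [Finset.mem_Icc] at hp
    rw [hden p hp.1 (by omega)]
    exact hc p hp.1 (by omega) (by omega)
  · have e : (Finset.Icc 1 m).erase s = insert m ((Finset.Icc 1 (m - 1)).erase s) := by
      ext; simp; omega
    rw [e, Finset.prod_insert (by simp; omega), hden m (by omega) le_rfl,
      ← Finset.mul_prod_erase (Finset.Icc 1 (m - 1)) _ (a := s) (by simp; omega)]
    have e1 : rowEll f m s - rowEll f (m - 1) s = 1 := by
      rw [rowEll, rowEll, hrow s hs hsm, hrow' s hs (by omega), if_pos rfl]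
      ring
    have e2 : ∏ p ∈ (Finset.Icc 1 (m - 1)).erase s, (rowEll f m s - rowEll f (m - 1) p)
        = ∏ p ∈ (Finset.Icc 1 (m - 1)).erase s, (rowEll f m s - rowEll f m p) := by
      refine Finset.prod_congr rfl fun p hp => ?_
      rw [Finset.mem_erase, Finset.mem_Icc] at hp
      rw [hnum p hp.2.1 hp.2.2 hp.1, hden p hp.2.1 (by omega)]
    rw [e1, e2, one_mul, div_mul_cancel_right₀]
    refine Finset.prod_ne_zero_iff.2 fun p hp => ?_
    rw [Finset.mem_erase, Finset.mem_Icc] at hp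
    rw [hden p hp.2.1 (by omega)]
    exact hc p hp.2.1 (by omega) hp.1

/-- The operator `E_{m+1,s}` lowers a whole column segment only along the path that goes through
the rows from row `s` up to row `m`, i.e. through the term `E_{m+1,m} ⋯ E_{s+1,s}` of the iterated
commutator: a pattern does not allow the entry in row `q + 1` to be lowered before that in row
`q`. -/
lemma IsLowering.repr_lowerCol (hF : IsLowering ξ F) {T : Pattern lam} {c : ℕ → ℝ} {s j : ℕ}
    (hs : 1 ≤ s) (hj : j ≤ r)
    (hT : ∀ q i, 1 ≤ i → i ≤ q → q ≤ j → T.entry q i = c i)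
    (hpat : IsPattern lam (lowerCol T.entry s j)) (m : ℕ) (hsm : s ≤ m) (hmj : m ≤ j)
    (Q : Pattern lam) (hQ : Q.entry = lowerCol T.entry s m) :
    ξ.repr (F (m + 1) s (ξ T)) Q =
      ∏ q ∈ Finset.Ioc s m, (((c s - s - (c q - q))⁻¹ : ℝ) : ℂ) := by
  have hc : ∀ i, 1 ≤ i → i ≤ j → i ≠ s → c s - s - (c i - i) ≠ 0 := by
    intro i hi hij his h
    rcases lt_or_gt_of_ne his with h' | h'
    · have h1 := T.isPattern.antitone (j := j) hi h'.le (by omega) (by omega)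
      rw [hT _ _ hi hij le_rfl, hT _ _ hs (by omega) le_rfl] at h1
      have : (i : ℝ) < s := by exact_mod_cast h'
      linarith
    · have h1 := T.isPattern.antitone (j := j) hs h'.le hij (by omega)
      rw [hT _ _ hi hij le_rfl, hT _ _ hs (by omega) le_rfl] at h1
      have : (s : ℝ) < i := by exact_mod_cast h'
      linarith
  induction m, hsm using Nat.le_induction generalizing Q with
  | base =>
    rw [hF.repr_simple_bump hs le_rfl (by omega) T Q, lowerCoeff_eq,
      rowLower_of_rows_eq (c := c) hs le_rfl, if_pos rfl]
    · simp
    · exact fun i hi him => hT _ _ hi him hmj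
    · intro i hi him
      rw [hT _ _ hi him (by omega), if_neg (by omega)]
    · exact fun i hi him => hc i hi (by omega)
    · rw [hQ]
      ext q i
      simp only [lowerCol, bump]
      split_ifs <;> first | omega | ring
  | succ m hsm ih =>
    set R : Pattern lam := ⟨_, isPattern_lowerCol hs hj (show m ≤ j by omega) hpat⟩ with hR
    have hRe : R.entry = lowerCol T.entry s m := rfl
    have h1 := hF.drops hs hsm (by omega)
    have h2 := hF.drops_simple (k := m + 1) (by omega) (by omega)
    have first : ξ.repr ((F (m + 1 + 1) (m + 1) * F (m + 1) s) (ξ T)) Q =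
        ξ.repr (F (m + 1) s (ξ T)) R * ξ.repr (F (m + 1 + 1) (m + 1) (ξ R)) Q := by
      refine repr_mul_of_unique _ _ _ _ _ fun R' hR1 hR2 => ?_
      have a := h1 _ _ hR1
      have b := h2 _ _ hR2
      refine Pattern.ext_of_range fun q i hi hiq hq => ?_
      by_cases hqm : q ≤ m
      · rw [← b.row_eq (by rw [rowsBetween, if_neg (by omega)]) hi hiq, hQ, hRe]
        simp only [lowerCol]
        split_ifs <;> first | omega | rfl
      · rw [a.row_eq (by rw [rowsBetween, if_neg (by omega)]) hi hiq, hRe]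
        simp only [lowerCol]
        rw [if_neg (by omega)]
    have second : ξ.repr ((F (m + 1) s * F (m + 1 + 1) (m + 1)) (ξ T)) Q = 0 := by
      rw [Module.End.mul_apply, repr_apply]
      refine Finset.sum_eq_zero fun R' _ => ?_
      by_contra hne
      have b := h2 _ _ (left_ne_zero_of_mul hne)
      have a := h1 _ _ (right_ne_zero_of_mul hne)
      -- row `m + 1` would be lowered before row `m`
      have e1 := b.row_eq (m := m) (by rw [rowsBetween, if_neg (by omega)]) hs hsm
      have e2 := a.row_eq (m := m + 1) (by rw [rowsBetween, if_neg (by omega)]) hs (by omega)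
      have e3 := R'.isPattern.le_up (j := m) hs hsm (by omega)
      rw [hQ, lowerCol, if_pos (by omega), hT _ _ hs (by omega) (by omega)] at e2
      rw [hT _ _ hs (by omega) (by omega)] at e1
      linarith
    rw [hF.comm (m + 1) s hs (by omega) (by omega), LinearMap.sub_apply, map_sub,
      Finsupp.sub_apply, first, second, sub_zero, ih (by omega) R hRe,
      hF.repr_simple_bump hs (by omega) (by omega) R Q, lowerCoeff_eq,
      rowLower_of_rows_eq (c := c) hs (by omega), if_neg (by omega),
      ← Finset.insert_Ioc_right_eq_Ioc_add_one (by omega), Finset.prod_insert (by simp), mul_comm]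
    · intro i hi him
      rw [hRe, lowerCol, if_neg (by omega), hT _ _ hi him (by omega)]
    · intro i hi him
      rw [Nat.add_sub_cancel] at him
      rw [hRe, lowerCol, Nat.add_sub_cancel, hT _ _ hi him (by omega)]
      split_ifs <;> first | omega | rfl
    · exact fun i hi him => hc i hi (by omega)
    · rw [hQ, hRe]
      ext q i
      simp only [lowerCol, bump]
      split_ifs <;> first | omega | ring

end Drop

/-! ### The monomials of one row -/

section Rows

variable {r : ℕ} {lam : Fin (r + 1) → ℝ}

/-- The entry function `f` with the rows up to `j` replaced by the initial segments of `c`. -/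
def capEntry (f : ℕ → ℕ → ℝ) (j : ℕ) (c : ℕ → ℝ) : ℕ → ℕ → ℝ :=
  fun m i => if 1 ≤ i ∧ i ≤ m ∧ m ≤ j then c i else f m i

lemma isPattern_capEntry (P : Pattern lam) {j : ℕ} {c : ℕ → ℝ} (hj : j ≤ r + 1)
    (hc : ∀ i, 1 ≤ i → i + 1 ≤ j → ∃ n : ℕ, c i - c (i + 1) = n)
    (hup : j ≤ r → ∀ i, 1 ≤ i → i ≤ j → (∃ n : ℕ, P.entry (j + 1) i - c i = n) ∧
      ∃ n : ℕ, c i - P.entry (j + 1) (i + 1) = n)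
    (htop : j = r + 1 → ∀ i, 1 ≤ i → i ≤ j → c i = P.entry j i) :
    IsPattern lam (capEntry P.entry j c) where
  outside m i h := by
    rw [capEntry, if_neg (by omega), P.isPattern.outside m i h]
  bounding i := by
    rw [← P.isPattern.bounding i, capEntry]
    split_ifs with h
    · obtain rfl : j = r + 1 := by omega
      exact htop rfl _ h.1 h.2.1
    · rfl
  upper m i hi him hm := by
    simp only [capEntry]
    split_ifs with h1 h2 h2
    · exact ⟨0, by simp⟩
    · omega
    · obtain rfl : m = j := by omega
      exact (hup hm i hi him).1
    · exact P.isPattern.upper m i hi him hm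
  lower m i hi him hm := by
    simp only [capEntry]
    split_ifs with h1 h2 h2
    · exact hc i hi (by omega)
    · obtain rfl : m = j := by omega
      exact (hup hm i hi him).2
    · omega
    · exact P.isPattern.lower m i hi him hm

lemma Pattern.exists_nat_antitone (P : Pattern lam) {j i : ℕ} (hi : 1 ≤ i) (hij : i + 1 ≤ j)
    (hj : j ≤ r + 1) : ∃ n : ℕ, P.entry j i - P.entry j (i + 1) = n := by
  obtain ⟨m, rfl⟩ : ∃ m, j = m + 1 := ⟨j - 1, by omega⟩
  obtain ⟨a, ha⟩ := P.isPattern.upper m i hi (by omega) (by omega)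
  obtain ⟨b, hb⟩ := P.isPattern.lower m i hi (by omega) (by omega)
  exact ⟨a + b, by push_cast; linarith⟩

/-- The row that interpolates between the rows `j + 1` (positions below `s`) and `j` (positions
above `s`) of a pattern; in position `s` it is the entry of row `j + 1`, lowered by `t`. -/
def midRow (P : Pattern lam) (j s t i : ℕ) : ℝ :=
  if i < s then P.entry (j + 1) i else if i = s then P.entry (j + 1) s - t else P.entry j i

/-- The integer `λ^{j+1}_i - λ^j_i`. -/
def gap (P : Pattern lam) (j i : ℕ) : ℕ := ⌊P.entry (j + 1) i - P.entry j i⌋₊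

lemma gap_cast (P : Pattern lam) {j i : ℕ} (hi : 1 ≤ i) (hij : i ≤ j) (hj : j ≤ r) :
    (gap P j i : ℝ) = P.entry (j + 1) i - P.entry j i := by
  obtain ⟨n, hn⟩ := P.isPattern.upper j i hi hij hj
  rw [gap, hn, Nat.floor_natCast]

lemma isPattern_midRow (P : Pattern lam) {j s t : ℕ} (hs : 1 ≤ s) (hsj : s ≤ j) (hj : j ≤ r)
    (ht : t ≤ gap P j s) : IsPattern lam (capEntry P.entry j (midRow P j s t)) := by
  have hd := gap_cast P hs hsj hj
  obtain ⟨e, he⟩ := Nat.exists_eq_add_of_le ht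
  have he' : (gap P j s : ℝ) = t + e := by exact_mod_cast he
  have hup : ∀ i, 1 ≤ i → i ≤ j → (∃ n : ℕ, P.entry (j + 1) i - midRow P j s t i = n) ∧
      ∃ n : ℕ, midRow P j s t i - P.entry (j + 1) (i + 1) = n := by
    intro i hi hij
    obtain ⟨a, ha⟩ := P.isPattern.upper j i hi hij hj
    obtain ⟨b, hb⟩ := P.isPattern.lower j i hi hij hj
    simp only [midRow]
    split_ifs with h1 h2
    · exact ⟨⟨0, by simp⟩, ⟨a + b, by push_cast; linarith⟩⟩
    · subst h2
      exact ⟨⟨t, by ring⟩, ⟨e + b, by push_cast; linarith⟩⟩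
    · exact ⟨⟨a, ha⟩, ⟨b, hb⟩⟩
  refine isPattern_capEntry P (by omega) (fun i hi hij => ?_) (fun _ => hup) (by omega)
  obtain ⟨a, ha⟩ := (hup i hi (by omega)).2
  obtain ⟨b, hb⟩ := (hup (i + 1) (by omega) hij).1
  exact ⟨a + b, by push_cast; linarith⟩

lemma isPattern_capEntry_self (P : Pattern lam) {j : ℕ} (hj : j ≤ r + 1) :
    IsPattern lam (capEntry P.entry j (P.entry j)) :=
  isPattern_capEntry P hj (fun _ hi hij => P.exists_nat_antitone hi hij hj)
    (fun h i hi hij => ⟨P.isPattern.upper j i hi hij h, P.isPattern.lower j i hi hij h⟩)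
    (fun _ _ _ _ => rfl)

/-- The pattern with the rows from `j` on of `P`, and with maximal rows below. -/
def maximize (P : Pattern lam) (j : ℕ) (hj : j ≤ r + 1) : Pattern lam :=
  ⟨_, isPattern_capEntry_self P hj⟩

lemma maximize_entry (P : Pattern lam) {j : ℕ} (hj : j ≤ r + 1) :
    (maximize P j hj).entry = capEntry P.entry j (P.entry j) := rfl

/-- The pattern with the rows from `j + 1` on of `P`, and whose other rows are initial segments of
`midRow P j s t`. -/
def midPattern (P : Pattern lam) (j s t : ℕ) (hs : 1 ≤ s ∧ s ≤ j ∧ j ≤ r) (ht : t ≤ gap P j s) :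
    Pattern lam :=
  ⟨_, isPattern_midRow P hs.1 hs.2.1 hs.2.2 ht⟩

lemma midPattern_entry (P : Pattern lam) {j s t : ℕ} (hs : 1 ≤ s ∧ s ≤ j ∧ j ≤ r)
    (ht : t ≤ gap P j s) :
    (midPattern P j s t hs ht).entry = capEntry P.entry j (midRow P j s t) := rfl

variable {M : Type*} [AddCommGroup M] [Module ℂ M] {ξ : Module.Basis (Pattern lam) ℂ M}
  {F : ℕ → ℕ → Module.End ℂ M}

lemma IsLowering.repr_midPattern_succ (hF : IsLowering ξ F) (P : Pattern lam) {j s t : ℕ}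
    (hs : 1 ≤ s ∧ s ≤ j ∧ j ≤ r) (ht : t + 1 ≤ gap P j s) :
    ξ.repr (F (j + 1) s (ξ (midPattern P j s t hs (by omega)))) (midPattern P j s (t + 1) hs ht) =
      ∏ q ∈ Finset.Ioc s j,
        (((P.ell (j + 1) s - P.ell j q - t)⁻¹ : ℝ) : ℂ) := by
  have e : (midPattern P j s (t + 1) hs ht).entry =
      lowerCol (midPattern P j s t hs (by omega)).entry s j := by
    ext q i
    simp only [midPattern_entry, lowerCol, capEntry, midRow]
    split_ifs <;> first | omega | rfl | (push_cast; ring)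
  rw [hF.repr_lowerCol (c := midRow P j s t) hs.1 hs.2.2 _ _ j hs.2.1 le_rfl _ e]
  · refine Finset.prod_congr rfl fun q hq => ?_
    rw [Finset.mem_Ioc] at hq
    rw [midRow, if_neg (by omega), if_pos rfl, midRow, if_neg (by omega), if_neg (by omega)]
    congr 2
    rw [Pattern.ell, Pattern.ell]
    ring
  · intro q i hi hiq hq
    rw [midPattern_entry, capEntry, if_pos ⟨hi, hiq, hq⟩]
  · rw [← e]
    exact Pattern.isPattern _

/-- In passing from `midPattern P j s 0` to `midPattern P j s n` by `E_{j+1,s}^n`, the intermediate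
patterns are the `midPattern P j s t`. -/
lemma IsLowering.repr_midPattern_pow (hF : IsLowering ξ F) (P : Pattern lam) {j s : ℕ}
    (hs : 1 ≤ s ∧ s ≤ j ∧ j ≤ r) (n : ℕ) (hn : n ≤ gap P j s) :
    ξ.repr ((F (j + 1) s ^ n) (ξ (midPattern P j s 0 hs (by omega)))) (midPattern P j s n hs hn) =
      ∏ t ∈ Finset.range n, ∏ q ∈ Finset.Ioc s j,
        (((P.ell (j + 1) s - P.ell j q - t)⁻¹ : ℝ) : ℂ) := by
  induction n with
  | zero => simp
  | succ n ih =>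
    have hdr := hF.drops hs.1 hs.2.1 hs.2.2
    rw [pow_succ', repr_mul_of_unique _ _ _ (midPattern P j s n hs (by omega)) _ ?_, ih (by omega),
      hF.repr_midPattern_succ P hs hn, Finset.prod_range_succ]
    intro R h1 h2
    have a := (hdr.pow n) _ _ h1
    have b := hdr _ _ h2
    have off : ∀ q i, i ≠ s → R.entry q i = (midPattern P j s n hs (by omega)).entry q i := by
      intro q i his
      have e1 := a.le q i
      have e2 := b.le q i
      simp only [midPattern_entry, capEntry, midRow] at e1 e2 ⊢
      simp only [if_neg his] at e1 e2 ⊢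
      exact le_antisymm e1 e2
    refine Pattern.ext_of_range fun q i hi hiq hq => ?_
    by_cases his : i = s
    · subst his
      by_cases hqj : q ≤ j
      · have hi' : i ∈ Finset.Icc 1 q := Finset.mem_Icc.2 ⟨hi, hiq⟩
        have hsum := a.rowSum q
        have e0 : ∀ t (ht : t ≤ gap P j i), (midPattern P j i t hs ht).rowSum q =
            P.entry (j + 1) i - t + ∑ p ∈ (Finset.Icc 1 q).erase i,
              (midPattern P j i n hs (by omega)).entry q p := by
          intro t ht
          rw [Pattern.rowSum, ← Finset.add_sum_erase _ _ hi']
          congr 1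
          · rw [midPattern_entry, capEntry, if_pos ⟨hi, hiq, hqj⟩, midRow, if_neg (by omega),
              if_pos rfl]
          · refine Finset.sum_congr rfl fun p hp => ?_
            have hp' := (Finset.mem_erase.1 hp).1
            simp only [midPattern_entry, capEntry, midRow, if_neg hp']
        rw [e0 0, Pattern.rowSum, ← Finset.add_sum_erase _ _ hi',
          Finset.sum_congr rfl fun p hp => off q p (Finset.mem_erase.1 hp).1, Pi.smul_apply,
          rowsBetween, if_pos ⟨hiq, hqj⟩] at hsum
        rw [midPattern_entry, capEntry, if_pos ⟨hi, hiq, hqj⟩, midRow, if_neg (by omega),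
          if_pos rfl]
        simp only [smul_eq_mul, mul_one, Nat.cast_zero] at hsum
        linarith
      · rw [a.row_eq (by
          rw [Pi.smul_apply, rowsBetween, if_neg (by omega), smul_zero]) hi hiq]
        simp only [midPattern_entry, capEntry, if_neg (show ¬ (1 ≤ i ∧ i ≤ q ∧ q ≤ j) by omega)]
    · exact off q i his

/-- The product of the divided powers `E_{j+1,i}^{(λ^{j+1}_i - λ^j_i)}` for `i ≤ s`. -/
def rowProd (F : ℕ → ℕ → Module.End ℂ M) (P : Pattern lam) (j s : ℕ) : Module.End ℂ M :=
  ((List.range' 1 s).map fun i => dividedPower (F (j + 1) i) (gap P j i)).prod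

lemma rowProd_succ (F : ℕ → ℕ → Module.End ℂ M) (P : Pattern lam) (j s : ℕ) :
    rowProd F P j (s + 1) =
      rowProd F P j s * dividedPower (F (j + 1) (s + 1)) (gap P j (s + 1)) := by
  rw [rowProd, List.range'_concat, List.map_append, List.prod_append, rowProd]
  simp [add_comm]

lemma IsLowering.drops_rowProd (hF : IsLowering ξ F) (P : Pattern lam) {j s : ℕ} (hsj : s ≤ j)
    (hj : j ≤ r) : Drops ξ (∑ i ∈ Finset.Icc 1 s, (gap P j i : ℝ) • rowsBetween i j)
      (rowProd F P j s) := by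
  induction s with
  | zero => exact Drops.one
  | succ s ih =>
    rw [rowProd_succ, Finset.sum_Icc_succ_top (by omega)]
    exact (ih (by omega)).mul ((hF.drops (by omega) hsj hj).dividedPower _)

/-- The contribution of the factor `E_{j+1,i}^{(λ^{j+1}_i - λ^j_i)}` to the diagonal coefficient. -/
def factorCoeff (P : Pattern lam) (j i : ℕ) : ℂ :=
  ((gap P j i).factorial : ℂ)⁻¹ * ∏ t ∈ Finset.range (gap P j i), ∏ q ∈ Finset.Ioc i j,
    (((P.ell (j + 1) i - P.ell j q - t)⁻¹ : ℝ) : ℂ)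

/-- If the lower rows of `T` are made of the first `s` entries of row `j + 1` of `P` and the later
entries of row `j`, then the factors `E_{j+1,s}, …, E_{j+1,1}` of `ρ_P^j` turn the former into
entries of row `j`, one position at a time. -/
lemma IsLowering.repr_rowProd (hF : IsLowering ξ F) (P : Pattern lam) {j s : ℕ} (hsj : s ≤ j)
    (hj : j ≤ r) (T : Pattern lam)
    (hT : T.entry = capEntry P.entry j fun i => if i ≤ s then P.entry (j + 1) i else P.entry j i) :
    ξ.repr (rowProd F P j s (ξ T)) (maximize P j (by omega)) =
      ∏ i ∈ Finset.Icc 1 s, factorCoeff P j i := by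
  induction s generalizing T with
  | zero =>
    have e : T = maximize P j (by omega) := by
      refine Pattern.ext_of_range fun q i hi hiq hq => ?_
      rw [hT, maximize_entry]
      simp only [capEntry]
      split_ifs <;> first | omega | rfl
    rw [e]
    simp [rowProd]
  | succ s ih =>
    have hs' : 1 ≤ s + 1 ∧ s + 1 ≤ j ∧ j ≤ r := ⟨by omega, hsj, hj⟩
    have hT0 : T = midPattern P j (s + 1) 0 hs' (by omega) := by
      refine Pattern.ext_of_range fun q i hi hiq hq => ?_
      rw [hT, midPattern_entry]
      simp only [capEntry, midRow]
      split_ifs with h1 h2 h3 h4 h5 <;> first | omega | rfl | (rw [h4]; simp)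
    have hd := gap_cast P hs'.1 hsj hj
    set R := midPattern P j (s + 1) (gap P j (s + 1)) hs' le_rfl with hRdef
    have hR : R.entry = capEntry P.entry j
        fun i => if i ≤ s then P.entry (j + 1) i else P.entry j i := by
      rw [hRdef, midPattern_entry]
      ext q i
      simp only [capEntry, midRow]
      split_ifs with h1 h2 h3 h4 h5 <;> first | omega | rfl | (rw [h4, hd]; ring)
    rw [rowProd_succ, repr_mul_of_unique _ _ _ R _ ?_, ih (by omega) R hR,
      Finset.prod_Icc_succ_top (by omega), mul_comm]
    · congr 1
      rw [dividedPower, LinearMap.smul_apply, map_smul, Finsupp.smul_apply, hT0,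
        hF.repr_midPattern_pow P hs' _ le_rfl, factorCoeff, smul_eq_mul]
    · intro R' h1 h2
      have a := ((hF.drops hs'.1 hsj hj).dividedPower _) _ _ h1
      have b := (hF.drops_rowProd P (by omega) hj) _ _ h2
      have low : ∀ q i, 1 ≤ i → i ≤ q → q ≤ s → R'.entry q i = P.entry (j + 1) i := by
        intro q i hi hiq hq
        rw [a.row_eq (by rw [Pi.smul_apply, rowsBetween, if_neg (by omega), smul_zero]) hi hiq, hT,
          capEntry, if_pos (by omega), if_pos (by omega)]
      refine Pattern.ext_of_range fun q i hi hiq hq => ?_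
      by_cases hqs : q ≤ s
      · rw [low q i hi hiq hqs, hR, capEntry, if_pos (by omega), if_pos (by omega)]
      by_cases hqj : q ≤ j
      · -- the rows `s + 1, …, j` of `R'` dominate those of `R` and have the same sum
        have hle : ∀ i, 1 ≤ i → i ≤ q → R.entry q i ≤ R'.entry q i := by
          intro i hi hiq
          rw [hR, capEntry, if_pos ⟨hi, hiq, hqj⟩]
          split_ifs with his
          · rw [← low s i hi his le_rfl]
            exact R'.isPattern.mono_row hi his (by omega) hq
          · have := b.le q i
            rwa [maximize_entry, capEntry, if_pos ⟨hi, hiq, hqj⟩] at this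
        refine (eq_of_le_of_sum_eq hle ?_ hi hiq).symm
        have hsum := a.rowSum q
        rw [Pi.smul_apply, rowsBetween, if_pos (by omega), smul_eq_mul, mul_one] at hsum
        rw [Pattern.rowSum, Pattern.rowSum] at hsum
        have hmem : s + 1 ∈ Finset.Icc 1 q := Finset.mem_Icc.2 ⟨by omega, by omega⟩
        have hrest : ∑ p ∈ (Finset.Icc 1 q).erase (s + 1), T.entry q p
            = ∑ p ∈ (Finset.Icc 1 q).erase (s + 1), R.entry q p := by
          refine Finset.sum_congr rfl fun p hp => ?_
          have hp' := (Finset.mem_erase.1 hp).1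
          rw [hT, hR]
          simp only [capEntry]
          split_ifs <;> first | omega | rfl
        rw [hsum, ← Finset.add_sum_erase _ _ hmem, ← Finset.add_sum_erase _ (R.entry q) hmem, hrest,
          hT, hR, capEntry, if_pos (by omega), if_pos le_rfl, capEntry, if_pos (by omega),
          if_neg (by omega)]
        linarith
      · rw [a.row_eq (by rw [Pi.smul_apply, rowsBetween, if_neg (by omega), smul_zero]) hi hiq,
          hT, hR]
        simp only [capEntry]
        split_ifs <;> first | omega | rfl

end Rows

/-! ### Triangularity -/

section Triangular

variable {r : ℕ} {lam : Fin (r + 1) → ℝ}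

lemma sum_gap_smul_rowsBetween (P : Pattern lam) {j : ℕ} (hj : j ≤ r) (m : ℕ) :
    (∑ i ∈ Finset.Icc 1 j, (gap P j i : ℝ) • rowsBetween i j) m =
      if m ≤ j then ∑ i ∈ Finset.Icc 1 m, (P.entry (j + 1) i - P.entry j i) else 0 := by
  rw [Finset.sum_apply]
  split_ifs with h
  · rw [← Finset.sum_subset (Finset.Icc_subset_Icc_right h)]
    · refine Finset.sum_congr rfl fun i hi => ?_
      rw [Finset.mem_Icc] at hi
      rw [Pi.smul_apply, rowsBetween, if_pos ⟨hi.2, h⟩, gap_cast P hi.1 (by omega) hj, smul_eq_mul,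
        mul_one]
    · intro i hi hi'
      rw [Finset.mem_Icc] at hi hi'
      rw [Pi.smul_apply, rowsBetween, if_neg (by omega), smul_zero]
  · refine Finset.sum_eq_zero fun i _ => ?_
    rw [Pi.smul_apply, rowsBetween, if_neg (by omega), smul_zero]

variable {M : Type*} [AddCommGroup M] [Module ℂ M] {ξ : Module.Basis (Pattern lam) ℂ M}
  {F : ℕ → ℕ → Module.End ℂ M}

/-- The product of the row monomials `ρ_P^j ⋯ ρ_P^{j+n-1}`. -/
def tailProd (F : ℕ → ℕ → Module.End ℂ M) (P : Pattern lam) (j n : ℕ) : Module.End ℂ M :=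
  ((List.range' j n).map fun j => rowProd F P j j).prod

lemma tailProd_succ (F : ℕ → ℕ → Module.End ℂ M) (P : Pattern lam) (j n : ℕ) :
    tailProd F P j (n + 1) = rowProd F P j j * tailProd F P (j + 1) n := by
  rw [tailProd, List.range'_succ, List.map_cons, List.prod_cons, tailProd]

lemma maximize_top (hlam : IsDominantIntegral lam) (P : Pattern lam) :
    maximize P (r + 1) le_rfl = topPattern hlam := by
  refine Pattern.ext_of_range fun q i hi hiq hq => ?_
  rw [topPattern_entry hlam hi hiq hq, maximize_entry, capEntry, if_pos ⟨hi, hiq, hq⟩,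
    bounding_pos P hi (by omega)]

/-- The patterns `Q` occurring in `ρ_P^j ⋯ ρ_P^r v`: the rows from `j` on dominate those of `P`, and
the sums of the other rows are those of initial segments of row `j` of `P`. -/
lemma IsLowering.support_tailProd (hF : IsLowering ξ F) (hlam : IsDominantIntegral lam)
    (P : Pattern lam) (n j : ℕ) (hj : 1 ≤ j) (hjn : j + n = r + 1) (Q : Pattern lam)
    (hQ : ξ.repr (tailProd F P j n (ξ (topPattern hlam))) Q ≠ 0) :
    (∀ m s, j ≤ m → m ≤ r + 1 → s ≤ m →
      ∑ i ∈ Finset.Icc 1 s, P.entry m i ≤ ∑ i ∈ Finset.Icc 1 s, Q.entry m i) ∧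
    ∀ m, m ≤ j → Q.rowSum m = ∑ i ∈ Finset.Icc 1 m, P.entry j i := by
  induction n generalizing j Q with
  | zero =>
    obtain rfl : j = r + 1 := by omega
    rw [show tailProd F P (r + 1) 0 = 1 from rfl] at hQ
    have hd := Drops.one _ _ hQ
    have e : ∀ m i, 1 ≤ i → i ≤ m → m ≤ r + 1 → Q.entry m i = P.entry (r + 1) i := by
      intro m i hi him hm
      rw [hd.row_eq rfl hi him, topPattern_entry hlam hi him hm, bounding_pos P hi (by omega)]
    refine ⟨fun m s hm hm' hs => (Finset.sum_congr rfl fun i hi => ?_).le,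
      fun m hm => Finset.sum_congr rfl fun i hi => ?_⟩
    · obtain rfl : m = r + 1 := by omega
      rw [Finset.mem_Icc] at hi
      rw [e _ i hi.1 (by omega) hm']
    · rw [Finset.mem_Icc] at hi
      rw [e m i hi.1 hi.2 hm]
  | succ n ih =>
    rw [tailProd_succ, Module.End.mul_apply, repr_apply] at hQ
    obtain ⟨R, _, hR⟩ := Finset.exists_ne_zero_of_sum_ne_zero hQ
    obtain ⟨ih1, ih2⟩ := ih (j + 1) (by omega) (by omega) R (left_ne_zero_of_mul hR)
    have hd := hF.drops_rowProd P le_rfl (show j ≤ r by omega) _ _ (right_ne_zero_of_mul hR)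
    have hrow : ∀ m, m ≤ j → Q.rowSum m = ∑ i ∈ Finset.Icc 1 m, P.entry j i := by
      intro m hm
      rw [hd.rowSum, ih2 m (by omega), sum_gap_smul_rowsBetween P (by omega), if_pos hm,
        Finset.sum_sub_distrib, sub_sub_cancel]
    refine ⟨fun m s hm hm' hs => ?_, hrow⟩
    rcases Nat.eq_or_lt_of_le hm with rfl | hm
    · -- a partial sum of row `j` is at least the sum of the shorter row `s`
      rw [← hrow s hs, Pattern.rowSum]
      refine Finset.sum_le_sum fun i hi => ?_
      rw [Finset.mem_Icc] at hi
      exact Q.isPattern.mono_row hi.1 hi.2 hs hm'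
    · refine (ih1 m s hm hm' hs).trans_eq (Finset.sum_congr rfl fun i hi => ?_)
      rw [Finset.mem_Icc] at hi
      rw [hd.row_eq _ hi.1 (by omega)]
      rw [sum_gap_smul_rowsBetween P (by omega), if_neg (by omega)]

lemma IsLowering.repr_tailProd (hF : IsLowering ξ F) (hlam : IsDominantIntegral lam)
    (P : Pattern lam) (n j : ℕ) (hj : 1 ≤ j) (hjn : j + n = r + 1) :
    ξ.repr (tailProd F P j n (ξ (topPattern hlam))) (maximize P j (by omega)) =
      ∏ m ∈ Finset.Icc j r, ∏ i ∈ Finset.Icc 1 m, factorCoeff P m i := by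
  induction n generalizing j with
  | zero =>
    obtain rfl : j = r + 1 := by omega
    rw [show tailProd F P (r + 1) 0 = 1 from rfl, maximize_top hlam]
    simp
  | succ n ih =>
    rw [tailProd_succ, Module.End.mul_apply, repr_apply,
      Finset.sum_eq_single (maximize P (j + 1) (by omega)), ih (j + 1) (by omega) (by omega),
      hF.repr_rowProd P le_rfl (by omega),
      show Finset.Icc j r = insert j (Finset.Icc (j + 1) r) by ext; simp; omega,
      Finset.prod_insert (by simp), mul_comm]
    · rw [maximize_entry]
      ext q i
      simp only [capEntry]
      split_ifs with h1 h2 h3 <;> first | omega | rfl | skip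
      obtain rfl : q = j + 1 := by omega
      rfl
    · intro R _ hne
      by_contra h
      have hd := hF.drops_rowProd P le_rfl (show j ≤ r by omega) _ _ (right_ne_zero_of_mul h)
      have hs := (hF.support_tailProd hlam P n (j + 1) (by omega) (by omega) R
        (left_ne_zero_of_mul h)).2
      have hup : ∀ q i, j + 1 ≤ q → 1 ≤ i → i ≤ q → R.entry q i = P.entry q i := by
        intro q i hq hi hiq
        rw [← hd.row_eq (by rw [sum_gap_smul_rowsBetween P (by omega), if_neg (by omega)]) hi hiq,
          maximize_entry, capEntry, if_neg (by omega)]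
      refine hne (Pattern.ext_of_range fun q i hi hiq hq => ?_)
      rw [maximize_entry, capEntry]
      split_ifs with hqj
      · refine eq_of_le_of_sum_eq (m := q) (a := R.entry q) (b := P.entry (j + 1))
          (fun i hi hiq => ?_) (hs q hqj.2.2).ge hi hiq
        rw [← hup (j + 1) i le_rfl hi (by omega)]
        exact R.isPattern.mono_row hi hiq hqj.2.2 (by omega)
      · exact hup q i (by omega) hi hiq
    · simp

lemma maximize_one (P : Pattern lam) : maximize P 1 (by omega) = P := by
  refine Pattern.ext_of_range fun q i hi hiq hq => ?_
  rw [maximize_entry, capEntry]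
  split_ifs with h
  · rw [show q = 1 by omega]
  · rfl

/-- A product of inverses of consecutive integers as a quotient of factorials. -/
lemma prod_range_inv_sub (N d : ℕ) (h : d ≤ N) :
    ∏ t ∈ Finset.range d, ((N : ℂ) - t)⁻¹ = ((N - d).factorial : ℂ) / (N.factorial : ℂ) := by
  induction d with
  | zero => simp [div_self (Nat.cast_ne_zero.2 N.factorial_ne_zero : (N.factorial : ℂ) ≠ 0)]
  | succ d ih =>
    rw [Finset.prod_range_succ, ih (by omega)]
    obtain ⟨m, rfl⟩ : ∃ m, N = d + 1 + m := ⟨N - (d + 1), by omega⟩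
    rw [show d + 1 + m - d = m + 1 by omega, show d + 1 + m - (d + 1) = m by omega,
      Nat.factorial_succ]
    have h1 : ((m : ℂ) + 1) ≠ 0 := by exact_mod_cast Nat.succ_ne_zero m
    have h2 : (((d + 1 + m).factorial : ℕ) : ℂ) ≠ 0 := Nat.cast_ne_zero.2 (Nat.factorial_ne_zero _)
    have h3 : (((d + 1 + m : ℕ) : ℂ) - d) = m + 1 := by push_cast; ring
    rw [h3]
    push_cast
    field_simp

lemma factorCoeff_eq (P : Pattern lam) {j i : ℕ} (hi : 1 ≤ i) (hij : i ≤ j) (hj : j ≤ r) :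
    factorCoeff P j i = ∏ p ∈ Finset.Ico i (j + 1),
      ((⌊P.ell j i - P.ell j p⌋₊.factorial : ℂ) /
        (⌊P.ell (j + 1) i - P.ell j p⌋₊.factorial : ℂ)) := by
  have hd := gap_cast P hi hij hj
  rw [factorCoeff, Finset.prod_comm,
    show Finset.Ico i (j + 1) = insert i (Finset.Ioc i j) by ext; simp; omega,
    Finset.prod_insert (by simp)]
  congr 1
  · have e1 : P.ell j i - P.ell j i = (0 : ℕ) := by simp
    have e2 : P.ell (j + 1) i - P.ell j i = (gap P j i : ℝ) := by
      rw [hd, Pattern.ell, Pattern.ell]; ring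
    rw [e1, e2, Nat.floor_natCast, Nat.floor_natCast]
    simp
  · refine Finset.prod_congr rfl fun q hq => ?_
    rw [Finset.mem_Ioc] at hq
    obtain ⟨a, ha⟩ : ∃ a : ℕ, P.ell j i - P.ell j q = a := by
      have : ∀ n, i + n ≤ j → ∃ a : ℕ, P.ell j i - P.ell j (i + n) = a := by
        intro n
        induction n with
        | zero => intro _; exact ⟨0, by simp⟩
        | succ n ih =>
          intro hn
          obtain ⟨a, ha⟩ := ih (by omega)
          obtain ⟨b, hb⟩ := P.exists_nat_antitone (j := j) (i := i + n) (by omega) (by omega)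
            (by omega)
          refine ⟨a + b + 1, ?_⟩
          rw [Pattern.ell, Pattern.ell] at ha ⊢
          rw [← add_assoc]
          push_cast at ha ⊢
          linarith
      obtain ⟨n, rfl⟩ := Nat.exists_eq_add_of_le hq.1.le
      exact this n hq.2
    have e2 : P.ell (j + 1) i - P.ell j q = (a + gap P j i : ℕ) := by
      push_cast
      rw [hd, ← ha]
      simp only [Pattern.ell]
      ring
    rw [ha, e2, Nat.floor_natCast, Nat.floor_natCast]
    have := prod_range_inv_sub (a + gap P j i) (gap P j i) (by omega)
    rw [Nat.add_sub_cancel] at this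
    rw [← this]
    refine Finset.prod_congr rfl fun t _ => ?_
    push_cast
    rfl

lemma prod_factorCoeff (P : Pattern lam) :
    ∏ j ∈ Finset.Icc 1 r, ∏ i ∈ Finset.Icc 1 j, factorCoeff P j i = diagCoeff P := by
  rw [diagCoeff]
  refine Finset.prod_bij' (fun j _ => j + 1) (fun j _ => j - 1) ?_ ?_ ?_ ?_ ?_
  · intro j hj; rw [Finset.mem_Icc] at hj ⊢; omega
  · intro j hj; rw [Finset.mem_Icc] at hj ⊢; omega
  · intro j hj; exact Nat.add_sub_cancel j 1
  · intro j hj; rw [Finset.mem_Icc] at hj; exact Nat.sub_add_cancel (by omega)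
  · intro j hj
    rw [Finset.mem_Icc] at hj
    refine Finset.prod_congr
      (by ext; simp only [Finset.mem_Icc, Finset.mem_Ico]; omega) fun i hi => ?_
    rw [Finset.mem_Ico] at hi
    rw [Nat.add_sub_cancel, factorCoeff_eq P hi.1 (by omega) hj.2]

lemma diagCoeff_ne_zero (P : Pattern lam) : diagCoeff P ≠ 0 := by
  refine Finset.prod_ne_zero_iff.2 fun j _ => Finset.prod_ne_zero_iff.2 fun i _ =>
    Finset.prod_ne_zero_iff.2 fun p _ => div_ne_zero ?_ ?_ <;>
  exact Nat.cast_ne_zero.2 (Nat.factorial_ne_zero _)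

/-- The vectors obtained by applying the monomials to the highest weight vector are triangular with
respect to the dominance order. -/
lemma IsLowering.le_of_repr_ne_zero (hF : IsLowering ξ F) (hlam : IsDominantIntegral lam)
    (P Q : Pattern lam) (hQ : ξ.repr (tailProd F P 1 r (ξ (topPattern hlam))) Q ≠ 0) : P ≤ Q :=
  fun m s _ hs hm =>
    (hF.support_tailProd hlam P r 1 le_rfl (by omega) Q hQ).1 m s (by omega) hm hs

lemma IsLowering.repr_self (hF : IsLowering ξ F) (hlam : IsDominantIntegral lam)
    (P : Pattern lam) :
    ξ.repr (tailProd F P 1 r (ξ (topPattern hlam))) P = diagCoeff P := by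
  have h := hF.repr_tailProd hlam P r 1 le_rfl (by omega)
  rwa [maximize_one, prod_factorCoeff] at h

lemma IsLowering.span_eq_top (hF : IsLowering ξ F) (hlam : IsDominantIntegral lam) :
    Submodule.span ℂ
      (Set.range fun P : Pattern lam => tailProd F P 1 r (ξ (topPattern hlam))) = ⊤ := by
  set S := Submodule.span ℂ
    (Set.range fun P : Pattern lam => tailProd F P 1 r (ξ (topPattern hlam)))
  have key : ∀ P, ξ P ∈ S := by
    intro P
    induction P using WellFoundedGT.induction with
    | ind P ih =>
      have hv : tailProd F P 1 r (ξ (topPattern hlam)) ∈ S := Submodule.subset_span ⟨P, rfl⟩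
      classical
      rw [← ξ.sum_repr (tailProd F P 1 r (ξ (topPattern hlam))),
        ← Finset.add_sum_erase _ _ (Finset.mem_univ P), hF.repr_self hlam] at hv
      have hrest : ∑ Q ∈ Finset.univ.erase P,
          ξ.repr (tailProd F P 1 r (ξ (topPattern hlam))) Q • ξ Q ∈ S := by
        refine Submodule.sum_mem _ fun Q hQ => ?_
        by_cases h : ξ.repr (tailProd F P 1 r (ξ (topPattern hlam))) Q = 0
        · rw [h, zero_smul]; exact S.zero_mem
        · exact S.smul_mem _ (ih Q (lt_of_le_of_ne (hF.le_of_repr_ne_zero hlam P Q h)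
            (Finset.mem_erase.1 hQ).1.symm))
      have := (S.add_mem_iff_left hrest).1 hv
      exact (S.smul_mem_iff (diagCoeff_ne_zero P)).1 this
  rw [eq_top_iff, ← ξ.span_eq]
  exact Submodule.span_le.2 (by rintro _ ⟨P, rfl⟩; exact key P)

end Triangular

/-! ### Uniqueness of irreducible highest weight modules -/

section Uniqueness

variable {ι : Type*}

/-- Operators `e k`, `f k`, `h k` that satisfy the relations between raising and lowering operators,
and between diagonal and lowering operators, of a Chevalley basis. -/
structure IsChevalley [DecidableEq ι] {M : Type*} [AddCommGroup M] [Module ℂ M] (a : ι → ι → ℂ)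
    (e f h : ι → Module.End ℂ M) : Prop where
  ef : ∀ k l, e k * f l = f l * e k + if k = l then h k else 0
  hf : ∀ k l, h k * f l = f l * h k + a k l • f l

/-- A subspace stable under the operators `e k` and `f k`. -/
def IsStable {M : Type*} [AddCommGroup M] [Module ℂ M] (e f : ι → Module.End ℂ M)
    (K : Submodule ℂ M) : Prop :=
  ∀ k, ∀ x ∈ K, e k x ∈ K ∧ f k x ∈ K

/-- The result of applying a word in the operators `f k` to `u`. -/
def word {M : Type*} [AddCommGroup M] [Module ℂ M] (f : ι → Module.End ℂ M) (u : M) :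
    List ι → M
  | [] => u
  | k :: l => f k (word f u l)

/-- The span of all words in the operators `f k`, applied to `u`. -/
def wordSpan {M : Type*} [AddCommGroup M] [Module ℂ M] (f : ι → Module.End ℂ M) (u : M) :
    Submodule ℂ M :=
  Submodule.span ℂ (Set.range (word f u))

section Words

variable [DecidableEq ι] {M : Type*} [AddCommGroup M] [Module ℂ M] {a : ι → ι → ℂ}
  {e f h : ι → Module.End ℂ M} {u : M}

lemma IsChevalley.h_word (H : IsChevalley a e f h) {c : ι → ℂ} (hu : ∀ k, h k u = c k • u) (k : ι)
    (l : List ι) : ∃ t : ℂ, h k (word f u l) = t • word f u l := by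
  induction l with
  | nil => exact ⟨c k, hu k⟩
  | cons i l ih =>
    obtain ⟨t, ht⟩ := ih
    refine ⟨t + a k i, ?_⟩
    have := LinearMap.congr_fun (H.hf k i) (word f u l)
    rw [Module.End.mul_apply, LinearMap.add_apply, Module.End.mul_apply, ht, map_smul,
      LinearMap.smul_apply, ← add_smul] at this
    exact this

lemma IsChevalley.e_word (H : IsChevalley a e f h) {c : ι → ℂ} (hu : ∀ k, h k u = c k • u)
    (eu : ∀ k, e k u = 0) (k : ι) (l : List ι) : e k (word f u l) ∈ wordSpan f u := by
  have fmem : ∀ i, ∀ x ∈ wordSpan f u, f i x ∈ wordSpan f u := by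
    intro i x hx
    induction hx using Submodule.span_induction with
    | mem x hx =>
      obtain ⟨l, rfl⟩ := hx
      exact Submodule.subset_span ⟨i :: l, rfl⟩
    | zero => rw [map_zero]; exact Submodule.zero_mem _
    | add x y _ _ hx hy => rw [map_add]; exact Submodule.add_mem _ hx hy
    | smul t x _ hx => rw [map_smul]; exact Submodule.smul_mem _ _ hx
  induction l with
  | nil => rw [word, eu]; exact Submodule.zero_mem _
  | cons i l ih =>
    have := LinearMap.congr_fun (H.ef k i) (word f u l)
    rw [Module.End.mul_apply, LinearMap.add_apply, Module.End.mul_apply] at this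
    rw [word, this]
    refine Submodule.add_mem _ (fmem i _ ih) ?_
    split_ifs
    · obtain ⟨t, ht⟩ := H.h_word hu k l
      rw [ht]
      exact Submodule.smul_mem _ _ (Submodule.subset_span ⟨l, rfl⟩)
    · exact Submodule.zero_mem _

lemma IsChevalley.isStable_wordSpan (H : IsChevalley a e f h) {c : ι → ℂ}
    (hu : ∀ k, h k u = c k • u) (eu : ∀ k, e k u = 0) : IsStable e f (wordSpan f u) := by
  intro k x hx
  induction hx using Submodule.span_induction with
  | mem x hx =>
    obtain ⟨l, rfl⟩ := hx
    exact ⟨H.e_word hu eu k l, Submodule.subset_span ⟨k :: l, rfl⟩⟩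
  | zero => rw [map_zero, map_zero]; exact ⟨Submodule.zero_mem _, Submodule.zero_mem _⟩
  | add x y _ _ hx hy =>
    rw [map_add, map_add]
    exact ⟨Submodule.add_mem _ hx.1 hy.1, Submodule.add_mem _ hx.2 hy.2⟩
  | smul t x _ hx =>
    rw [map_smul, map_smul]
    exact ⟨Submodule.smul_mem _ _ hx.1, Submodule.smul_mem _ _ hx.2⟩

end Words

variable {V W : Type*} [AddCommGroup V] [Module ℂ V] [AddCommGroup W] [Module ℂ W]
  {a : ι → ι → ℂ} {eV fV hV : ι → Module.End ℂ V} {eW fW hW : ι → Module.End ℂ W}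

lemma IsChevalley.prod [DecidableEq ι] (HV : IsChevalley a eV fV hV) (HW : IsChevalley a eW fW hW) :
    IsChevalley a (fun k => (eV k).prodMap (eW k)) (fun k => (fV k).prodMap (fW k))
      (fun k => (hV k).prodMap (hW k)) where
  ef k l := by
    refine LinearMap.ext fun x => Prod.ext ?_ ?_
    · have := LinearMap.congr_fun (HV.ef k l) x.1
      split_ifs at this ⊢ <;> simpa using this
    · have := LinearMap.congr_fun (HW.ef k l) x.2
      split_ifs at this ⊢ <;> simpa using this
  hf k l := by
    refine LinearMap.ext fun x => Prod.ext ?_ ?_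
    · simpa using LinearMap.congr_fun (HV.hf k l) x.1
    · simpa using LinearMap.congr_fun (HW.hf k l) x.2

/-- The words applied to `(v, w)` do not span `(v, 0)`: a functional `φ` that vanishes on all
non-empty words excludes the empty word, and the grading operator `D` excludes the others. -/
lemma not_mem_wordSpan_prod {v : V} {w : W} (hv : v ≠ 0) (D : Module.End ℂ V) (c : ℂ)
    (hD : D v = c • v) (hDf : ∀ k, D * fV k = fV k * D - fV k) (φ : W →ₗ[ℂ] ℂ) (hφ : φ w ≠ 0)
    (hφf : ∀ k x, φ (fW k x) = 0) :
    ((v, 0) : V × W) ∉ wordSpan (fun k => (fV k).prodMap (fW k)) (v, w) := by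
  set f := fun k => (fV k).prodMap (fW k) with hf
  set N₀ : Submodule ℂ (V × W) :=
    Submodule.span ℂ (Set.range fun p : ι × List ι => word f (v, w) (p.1 :: p.2)) with hN₀
  have hword : ∀ l, D (word f (v, w) l).1 = (c - l.length) • (word f (v, w) l).1 := by
    intro l
    induction l with
    | nil => simpa [word] using hD
    | cons k l ih =>
      have := LinearMap.congr_fun (hDf k) (word f (v, w) l).1
      rw [Module.End.mul_apply, LinearMap.sub_apply, Module.End.mul_apply, ih, map_smul] at this
      have e : (word f (v, w) (k :: l)).1 = fV k (word f (v, w) l).1 := rfl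
      rw [e, this, List.length_cons]
      push_cast
      module
  have h1 : N₀ ≤ (⨆ μ ≠ c, D.eigenspace μ).comap (LinearMap.fst ℂ V W) := by
    rw [hN₀, Submodule.span_le]
    rintro _ ⟨⟨k, l⟩, rfl⟩
    have hne : c - ((k :: l).length : ℕ) ≠ c := by
      rw [Ne, sub_eq_self]
      exact Nat.cast_ne_zero.2 (by simp)
    exact Submodule.mem_iSup_of_mem _ (Submodule.mem_iSup_of_mem hne
      (Module.End.mem_eigenspace_iff.2 (hword (k :: l))))
  have h2 : N₀ ≤ (LinearMap.ker φ).comap (LinearMap.snd ℂ V W) := by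
    rw [hN₀, Submodule.span_le]
    rintro _ ⟨⟨k, l⟩, rfl⟩
    exact hφf k _
  have h3 : wordSpan f (v, w) ≤ Submodule.span ℂ {((v, w) : V × W)} ⊔ N₀ := by
    rw [wordSpan, Submodule.span_le]
    rintro _ ⟨l, rfl⟩
    cases l with
    | nil => exact Submodule.mem_sup_left (Submodule.mem_span_singleton_self _)
    | cons k l => exact Submodule.mem_sup_right (Submodule.subset_span ⟨(k, l), rfl⟩)
  intro hmem
  obtain ⟨y, hy, z, hz, hyz⟩ := Submodule.mem_sup.1 (h3 hmem)
  obtain ⟨t, rfl⟩ := Submodule.mem_span_singleton.1 hy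
  have e2 := congrArg Prod.snd hyz
  simp only [Prod.snd_add, Prod.smul_snd] at e2
  have e3 := congrArg φ e2
  have hz2 : φ z.2 = 0 := h2 hz
  rw [map_add, map_smul, hz2, add_zero, map_zero, smul_eq_mul, mul_eq_zero, or_iff_left hφ] at e3
  rw [e3, zero_smul, zero_add] at hyz
  have hz1 : z.1 ∈ ⨆ μ ≠ c, D.eigenspace μ := h1 hz
  rw [hyz] at hz1
  exact hv (Submodule.disjoint_def.1 (D.eigenspaces_iSupIndep c) v
    (Module.End.mem_eigenspace_iff.2 hD) hz1)

/-- Two irreducible highest weight modules of the same highest weight are isomorphic: the submodule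
generated by `(v, w)` is the graph of an isomorphism. -/
theorem exists_equiv_of_isChevalley [DecidableEq ι]
    (HV : IsChevalley a eV fV hV) (HW : IsChevalley a eW fW hW)
    {v : V} {w : W} {c : ι → ℂ} (hvne : v ≠ 0) (hwne : w ≠ 0)
    (heV : ∀ k, eV k v = 0) (heW : ∀ k, eW k w = 0)
    (hhV : ∀ k, hV k v = c k • v) (hhW : ∀ k, hW k w = c k • w)
    (simpleV : ∀ K : Submodule ℂ V, IsStable eV fV K → K ≠ ⊥ → K = ⊤)
    (simpleW : ∀ K : Submodule ℂ W, IsStable eW fW K → K ≠ ⊥ → K = ⊤)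
    (D : Module.End ℂ V) (d : ℂ) (hD : D v = d • v) (hDf : ∀ k, D * fV k = fV k * D - fV k)
    (φ : W →ₗ[ℂ] ℂ) (hφ : φ w ≠ 0) (hφf : ∀ k x, φ (fW k x) = 0) :
    ∃ Φ : W ≃ₗ[ℂ] V, Φ w = v ∧ (∀ k x, Φ (eW k x) = eV k (Φ x)) ∧
      ∀ k x, Φ (fW k x) = fV k (Φ x) := by
  set N := wordSpan (fun k => (fV k).prodMap (fW k)) ((v, w) : V × W) with hN
  have hstab : IsStable (fun k => (eV k).prodMap (eW k)) (fun k => (fV k).prodMap (fW k)) N :=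
    (HV.prod HW).isStable_wordSpan (c := c)
      (fun k => Prod.ext (by simpa using hhV k) (by simpa using hhW k))
      (fun k => Prod.ext (by simpa using heV k) (by simpa using heW k))
  have hvw : (v, w) ∈ N := Submodule.subset_span ⟨[], rfl⟩
  have hv0 : ((v, 0) : V × W) ∉ N := not_mem_wordSpan_prod hvne D d hD hDf φ hφ hφf
  have h0w : ((0, w) : V × W) ∉ N := by
    intro h
    have := N.sub_mem hvw h
    simp only [Prod.mk_sub_mk, sub_zero, sub_self] at this
    exact hv0 this
  -- the projections of `N` to `V` and to `W` are bijective
  have surjV : N.map (LinearMap.fst ℂ V W) = ⊤ := by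
    refine simpleV _ ?_ fun h => hvne ?_
    · rintro k _ ⟨x, hx, rfl⟩
      exact ⟨⟨_, (hstab k x hx).1, rfl⟩, ⟨_, (hstab k x hx).2, rfl⟩⟩
    · have : v ∈ N.map (LinearMap.fst ℂ V W) := ⟨_, hvw, rfl⟩
      rwa [h, Submodule.mem_bot] at this
  have surjW : N.map (LinearMap.snd ℂ V W) = ⊤ := by
    refine simpleW _ ?_ fun h => hwne ?_
    · rintro k _ ⟨x, hx, rfl⟩
      exact ⟨⟨_, (hstab k x hx).1, rfl⟩, ⟨_, (hstab k x hx).2, rfl⟩⟩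
    · have : w ∈ N.map (LinearMap.snd ℂ V W) := ⟨_, hvw, rfl⟩
      rwa [h, Submodule.mem_bot] at this
  have injV : N.comap (LinearMap.inr ℂ V W) = ⊥ := by
    by_contra h
    have := simpleW _ (fun k x hx => by
      have := hstab k _ hx
      simpa using this) h
    exact h0w (show w ∈ N.comap (LinearMap.inr ℂ V W) by rw [this]; trivial)
  have injW : N.comap (LinearMap.inl ℂ V W) = ⊥ := by
    by_contra h
    have := simpleV _ (fun k x hx => by
      have := hstab k _ hx
      simpa using this) h
    exact hv0 (show v ∈ N.comap (LinearMap.inl ℂ V W) by rw [this]; trivial)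
  have bijV : Function.Bijective ((LinearMap.fst ℂ V W).comp N.subtype) := by
    constructor
    · rw [← LinearMap.ker_eq_bot, eq_bot_iff]
      rintro ⟨⟨x, y⟩, hxy⟩ hx
      obtain rfl : x = 0 := hx
      have : y ∈ N.comap (LinearMap.inr ℂ V W) := hxy
      rw [injV, Submodule.mem_bot] at this
      subst this
      rfl
    · intro x
      have : x ∈ N.map (LinearMap.fst ℂ V W) := by rw [surjV]; trivial
      obtain ⟨y, hy, rfl⟩ := this
      exact ⟨⟨y, hy⟩, rfl⟩
  have bijW : Function.Bijective ((LinearMap.snd ℂ V W).comp N.subtype) := by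
    constructor
    · rw [← LinearMap.ker_eq_bot, eq_bot_iff]
      rintro ⟨⟨x, y⟩, hxy⟩ hx
      obtain rfl : y = 0 := hx
      have : x ∈ N.comap (LinearMap.inl ℂ V W) := hxy
      rw [injW, Submodule.mem_bot] at this
      subst this
      rfl
    · intro x
      have : x ∈ N.map (LinearMap.snd ℂ V W) := by rw [surjW]; trivial
      obtain ⟨y, hy, rfl⟩ := this
      exact ⟨⟨y, hy⟩, rfl⟩
  set ΦV := LinearEquiv.ofBijective _ bijV
  set ΦW := LinearEquiv.ofBijective _ bijW
  have key : ∀ x : N, (ΦW.symm ≪≫ₗ ΦV) x.1.2 = x.1.1 := by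
    intro x
    have : ΦW.symm x.1.2 = x := ΦW.symm_apply_apply x
    rw [LinearEquiv.trans_apply, this]
    rfl
  refine ⟨ΦW.symm ≪≫ₗ ΦV, key ⟨_, hvw⟩, fun k x => ?_, fun k x => ?_⟩
  · obtain ⟨y, rfl⟩ := ΦW.surjective x
    exact (key ⟨_, (hstab k y.1 y.2).1⟩).trans (congrArg (eV k) (key y).symm)
  · obtain ⟨y, rfl⟩ := ΦW.surjective x
    exact (key ⟨_, (hstab k y.1 y.2).2⟩).trans (congrArg (fV k) (key y).symm)

end Uniqueness

/-! ### The model on patterns -/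

section Model

variable {r : ℕ} {lam : Fin (r + 1) → ℝ}

lemma topPattern_weight (hlam : IsDominantIntegral lam) {k : ℕ} (hk : 1 ≤ k)
    (hkr : k ≤ r + 1) : (topPattern hlam).weight k = lam (pos r k) := by
  have e : ∀ j, j ≤ r + 1 → (topPattern hlam).rowSum j = ∑ i ∈ Finset.Icc 1 j, lam (pos r i) :=
    fun j hj => Finset.sum_congr rfl fun i hi => by
      rw [Finset.mem_Icc] at hi
      exact topPattern_entry hlam hi.1 hi.2 hj
  obtain ⟨m, rfl⟩ : ∃ m, k = m + 1 := ⟨k - 1, by omega⟩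
  rw [Pattern.weight, Nat.add_sub_cancel, e _ hkr, e _ (by omega),
    Finset.sum_Icc_succ_top (by omega), add_sub_cancel_left]

/-- The top pattern is the only one of weight `lam`, since entries are bounded by those of `lam`. -/
lemma eq_topPattern_of_weight (hlam : IsDominantIntegral lam) (P : Pattern lam)
    (h : ∀ i : Fin (r + 1), P.weight (i.val + 1) = lam i) : P = topPattern hlam := by
  have hsum : ∀ k, k ≤ r + 1 → P.rowSum k = ∑ i ∈ Finset.Icc 1 k, lam (pos r i) := by
    intro k
    induction k with
    | zero => intro _; simp [Pattern.rowSum]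
    | succ k ih =>
      intro hk
      have h1 := h (pos r (k + 1))
      rw [pos_val (by omega) hk, Nat.add_sub_cancel, Pattern.weight, Nat.add_sub_cancel,
        ih (by omega)] at h1
      rw [Finset.sum_Icc_succ_top (by omega), ← h1]
      ring
  refine Pattern.ext_of_range fun j i hi hij hj => ?_
  rw [topPattern_entry hlam hi hij hj]
  refine eq_of_le_of_sum_eq (m := j) (a := P.entry j) (b := fun i => lam (pos r i))
    (fun i hi hij => ?_) (hsum j hj).ge hi hij
  rw [← bounding_pos P hi (by omega)]
  exact P.isPattern.mono_row hi hij hj le_rfl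

/-- The indices `1, …, r` of the simple roots. -/
abbrev Simple (r : ℕ) : Type := {k : ℕ // 1 ≤ k ∧ k ≤ r}

variable {M : Type*} [AddCommGroup M] [Module ℂ M] (ξ : Module.Basis (Pattern lam) ℂ M)

lemma isChevalley_model : IsChevalley (fun k l : Simple r => negCartan k.1 l.1)
    (fun k => raiseOp ξ k.1) (fun k => lowerOp ξ k.1) (fun k => cartanOp ξ k.1) where
  ef k l := by
    split_ifs with h
    · subst h
      exact raiseOp_lowerOp_self ξ k.2.1 k.2.2
    · rw [add_zero]
      exact raiseOp_lowerOp_of_ne ξ k.2.2 l.2.2 fun h' => h (Subtype.ext h')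
  hf k l := cartanOp_lowerOp ξ k.2.1 l.2.1

/-- The operators `E_{p,q}`, for `q < p`, obtained from the operators `f k = E_{k+1,k}` as iterated
commutators. -/
def lowerFamily (f : ℕ → Module.End ℂ M) : ℕ → ℕ → Module.End ℂ M
  | 0, _ => 0
  | j + 1, i => if i = j then f j else f j * lowerFamily f j i - lowerFamily f j i * f j

lemma lowerFamily_self (f : ℕ → Module.End ℂ M) (k : ℕ) : lowerFamily f (k + 1) k = f k := by
  rw [lowerFamily, if_pos rfl]

lemma isLowering_model : IsLowering ξ (lowerFamily (lowerOp ξ)) where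
  simple k _ _ P := by rw [lowerFamily_self, lowerOp_basis]
  comm j i _ hij _ := by rw [lowerFamily_self, lowerFamily, if_neg (by omega)]

lemma simple_model (hlam : IsDominantIntegral lam) (K : Submodule ℂ M)
    (hK : IsStable (fun k : Simple r => raiseOp ξ k.1) (fun k => lowerOp ξ k.1) K)
    (hne : K ≠ ⊥) : K = ⊤ := by
  have htop : ξ (topPattern hlam) ∈ K :=
    basis_top_mem_of_stable ξ hlam K (fun k hk hkr x hx => (hK ⟨k, hk, hkr⟩ x hx).1) hne
  -- the operators that preserve `K`
  let A : Subalgebra ℂ (Module.End ℂ M) :=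
    { carrier := {T | ∀ x ∈ K, T x ∈ K}
      mul_mem' := fun ha hb x hx => ha _ (hb x hx)
      add_mem' := fun ha hb x hx => K.add_mem (ha x hx) (hb x hx)
      algebraMap_mem' := fun c x hx => K.smul_mem c hx }
  have hf : ∀ k, 1 ≤ k → k ≤ r → lowerOp ξ k ∈ A := fun k hk hkr x hx => (hK ⟨k, hk, hkr⟩ x hx).2
  have hfam : ∀ j i, 1 ≤ i → i ≤ j → j ≤ r → lowerFamily (lowerOp ξ) (j + 1) i ∈ A := by
    intro j i hi hij
    induction j, hij using Nat.le_induction with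
    | base => intro hj; rw [lowerFamily_self]; exact hf i hi hj
    | succ j hij ih =>
      intro hj
      have h1 := hf (j + 1) (by omega) hj
      have h2 := ih (by omega)
      rw [lowerFamily, if_neg (by omega)]
      exact A.sub_mem (A.mul_mem h1 h2) (A.mul_mem h2 h1)
  have htail : ∀ P : Pattern lam, tailProd (lowerFamily (lowerOp ξ)) P 1 r ∈ A := by
    intro P
    refine A.list_prod_mem fun T hT => ?_
    obtain ⟨j, hj, rfl⟩ := List.mem_map.1 hT
    rw [List.mem_range'_1] at hj
    refine A.list_prod_mem fun T hT => ?_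
    obtain ⟨i, hi, rfl⟩ := List.mem_map.1 hT
    rw [List.mem_range'_1] at hi
    exact A.smul_mem (A.pow_mem (hfam j i hi.1 (by omega) (by omega)) _) _
  rw [eq_top_iff, ← (isLowering_model ξ).span_eq_top hlam, Submodule.span_le]
  rintro _ ⟨P, rfl⟩
  exact htail P _ htop

/-- No `E_{k+1,k} ξ_P` involves the top pattern, whose entries are the largest ones. -/
lemma coord_top_lowerOp (hlam : IsDominantIntegral lam) {k : ℕ} (hk : 1 ≤ k) (hkr : k ≤ r) (x : M) :
    ξ.coord (topPattern hlam) (lowerOp ξ k x) = 0 := by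
  rw [Module.Basis.coord_apply, repr_apply]
  refine Finset.sum_eq_zero fun P _ => ?_
  by_contra h
  have hd := (isLowering_model ξ).drops_simple hk hkr P (topPattern hlam)
    (by rw [lowerFamily_self]; exact right_ne_zero_of_mul h)
  have h1 := hd.rowSum k
  rw [rowsBetween, if_pos ⟨le_rfl, le_rfl⟩] at h1
  have h2 : P.rowSum k ≤ (topPattern hlam).rowSum k := by
    refine Finset.sum_le_sum fun i hi => ?_
    rw [Finset.mem_Icc] at hi
    rw [topPattern_entry hlam hi.1 hi.2 (by omega), ← bounding_pos P hi.1 (by omega)]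
    exact P.isPattern.mono_row hi.1 hi.2 (by omega) le_rfl
  linarith

lemma raiseOp_top (hlam : IsDominantIntegral lam) {k : ℕ} (hkr : k ≤ r) :
    raiseOp ξ k (ξ (topPattern hlam)) = 0 := by
  rw [raiseOp_basis, neg_eq_zero]
  refine Finset.sum_eq_zero fun i hi => ?_
  have hi' := Finset.mem_Icc.1 hi
  rw [shift_eq_bump, extendZero_of_not, smul_zero]
  intro h
  have h1 := h.le_up hi'.1 hi'.2 hkr
  rw [bump_self, bump_of_ne _ _ (by omega), topPattern_entry hlam hi'.1 hi'.2 (by omega),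
    topPattern_entry hlam hi'.1 (by omega) (by omega)] at h1
  linarith

end Model

/-! ### The special linear Lie algebra -/

section SL

variable {r : ℕ}

lemma pos_inj {r p q : ℕ} (hp : 1 ≤ p ∧ p ≤ r + 1) (hq : 1 ≤ q ∧ q ≤ r + 1) :
    pos r p = pos r q ↔ p = q := by
  rw [← Fin.val_inj, pos_val hp.1 hp.2, pos_val hq.1 hq.2]
  omega

lemma val_matUnit {p q : ℕ} (hp : 1 ≤ p ∧ p ≤ r + 1) (hq : 1 ≤ q ∧ q ≤ r + 1) (hpq : p ≠ q) :
    (matUnit r p q).val = Matrix.single (pos r p) (pos r q) (1 : ℂ) := by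
  rw [matUnit, dif_pos (by rwa [Ne, pos_inj hp hq])]
  rfl

lemma val_coroot (k : ℕ) : (coroot r k).val =
    Matrix.single (pos r k) (pos r k) (1 : ℂ) -
      Matrix.single (pos r (k + 1)) (pos r (k + 1)) (1 : ℂ) := rfl

lemma single_mul_single_ite (i j k l : Fin (r + 1)) :
    Matrix.single i j (1 : ℂ) * Matrix.single k l 1 = if j = k then Matrix.single i l 1 else 0 := by
  split_ifs with h
  · subst h
    rw [Matrix.single_mul_single_same, mul_one]
  · rw [Matrix.single_mul_single_of_ne (h := h)]

lemma lie_matUnit {p q s : ℕ} (hp : 1 ≤ p ∧ p ≤ r + 1) (hq : 1 ≤ q ∧ q ≤ r + 1)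
    (hs : 1 ≤ s ∧ s ≤ r + 1) (hpq : p ≠ q) (hqs : q ≠ s) (hps : p ≠ s) :
    ⁅matUnit r p q, matUnit r q s⁆ = matUnit r p s := by
  apply Subtype.ext
  rw [LieAlgebra.SpecialLinear.sl_bracket, val_matUnit hp hq hpq, val_matUnit hq hs hqs,
    val_matUnit hp hs hps, single_mul_single_ite, single_mul_single_ite, if_pos rfl, if_neg,
    sub_zero]
  rw [pos_inj hs hp]
  exact hps.symm

lemma lie_raise_lower {k l : ℕ} (hk : 1 ≤ k ∧ k ≤ r) (hl : 1 ≤ l ∧ l ≤ r) :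
    ⁅matUnit r k (k + 1), matUnit r (l + 1) l⁆ = if k = l then coroot r k else 0 := by
  apply Subtype.ext
  rw [LieAlgebra.SpecialLinear.sl_bracket, val_matUnit (by omega) (by omega) (by omega),
    val_matUnit (by omega) (by omega) (by omega), single_mul_single_ite, single_mul_single_ite]
  simp only [pos_inj (r := r) (p := k + 1) (q := l + 1) (by omega) (by omega),
    pos_inj (r := r) (p := l) (q := k) (by omega) (by omega)]
  split_ifs with h1 h2 h3 h3 <;> first | omega | skip
  · subst h2; rw [val_coroot]
  · simp

lemma lie_coroot_lower {k l : ℕ} (hk : 1 ≤ k ∧ k ≤ r) (hl : 1 ≤ l ∧ l ≤ r) :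
    ⁅coroot r k, matUnit r (l + 1) l⁆ = negCartan k l • matUnit r (l + 1) l := by
  have left : ∀ i k l : Fin (r + 1), Matrix.single i i (1 : ℂ) * Matrix.single k l 1 =
      (if i = k then (1 : ℂ) else 0) • Matrix.single k l (1 : ℂ) := by
    intro i k l
    rw [single_mul_single_ite]
    split_ifs with h
    · rw [h, one_smul]
    · rw [zero_smul]
  have right : ∀ i k l : Fin (r + 1), Matrix.single k l (1 : ℂ) * Matrix.single i i 1 =
      (if l = i then (1 : ℂ) else 0) • Matrix.single k l (1 : ℂ) := by
    intro i k l
    rw [single_mul_single_ite]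
    split_ifs with h
    · rw [h, one_smul]
    · rw [zero_smul]
  apply Subtype.ext
  rw [LieAlgebra.SpecialLinear.sl_bracket, val_coroot]
  change _ = negCartan k l • (matUnit r (l + 1) l).val
  rw [val_matUnit (by omega) (by omega) (by omega), sub_mul, mul_sub, left, left, right, right,
    ← sub_smul, ← sub_smul, ← sub_smul]
  simp only [pos_inj (r := r) (p := k) (q := l + 1) (by omega) (by omega),
    pos_inj (r := r) (p := k + 1) (q := l + 1) (by omega) (by omega),
    pos_inj (r := r) (p := l) (q := k) (by omega) (by omega),
    pos_inj (r := r) (p := l) (q := k + 1) (by omega) (by omega), negCartan]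
  congr 1
  split_ifs <;> first | omega | norm_num

/-- The diagonal matrix with entries `c - i`, where `c` is chosen such that the trace is zero. All
the `E_{k+1,k}` are eigenvectors of its adjoint action, with eigenvalue `-1`. -/
def gradingElement (r : ℕ) : slC r :=
  ⟨Matrix.diagonal fun i : Fin (r + 1) => (∑ j : Fin (r + 1), (j.val : ℂ)) / (r + 1) - (i.val : ℂ),
    by
      have h : ((r : ℂ) + 1) ≠ 0 := by exact_mod_cast Nat.succ_ne_zero r
      change Matrix.trace (Matrix.diagonal fun i : Fin (r + 1) =>
        (∑ j : Fin (r + 1), (j.val : ℂ)) / (r + 1) - (i.val : ℂ)) = 0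
      rw [Matrix.trace_diagonal, Finset.sum_sub_distrib, Finset.sum_const, Finset.card_univ,
        Fintype.card_fin, nsmul_eq_mul]
      push_cast
      rw [mul_div_cancel₀ _ h, sub_self]⟩

lemma lie_gradingElement_lower {l : ℕ} (hl : 1 ≤ l ∧ l ≤ r) :
    ⁅gradingElement r, matUnit r (l + 1) l⁆ = -matUnit r (l + 1) l := by
  apply Subtype.ext
  rw [LieAlgebra.SpecialLinear.sl_bracket]
  change _ = -(matUnit r (l + 1) l).val
  rw [val_matUnit (by omega) (by omega) (by omega), gradingElement]
  ext i j
  rw [Matrix.sub_apply, Matrix.diagonal_mul, Matrix.mul_diagonal, Matrix.neg_apply,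
    Matrix.single_apply]
  split_ifs with h
  · rw [← h.1, ← h.2, pos_val (by omega) (by omega), pos_val (by omega) (by omega),
      Nat.add_sub_cancel, Nat.cast_sub hl.1]
    push_cast
    ring
  · ring

lemma eq_sum_elementary (x : slC r) : x = ∑ i : Fin (r + 1), ∑ j : Fin (r + 1),
    if h : i = j then LieAlgebra.SpecialLinear.singleSubSingle i 0 (x.val i i)
      else LieAlgebra.SpecialLinear.single i j h (x.val i j) := by
  apply Subtype.ext
  have htr : ∑ i, x.val i i = 0 := x.2
  have e : ∀ i j : Fin (r + 1),
      (if h : i = j then LieAlgebra.SpecialLinear.singleSubSingle i 0 (x.val i i)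
        else LieAlgebra.SpecialLinear.single i j h (x.val i j) : slC r).val =
      Matrix.single i j (x.val i j) - if i = j then Matrix.single 0 0 (x.val i i) else 0 := by
    intro i j
    split_ifs with h
    · subst h; rfl
    · rw [sub_zero]; rfl
  have cast : ∀ (s : Finset (Fin (r + 1))) (g : Fin (r + 1) → slC r),
      (∑ i ∈ s, g i).val = ∑ i ∈ s, (g i).val := fun s g =>
    map_sum (AddMonoidHom.mk' (fun x : slC r => x.val) fun _ _ => rfl) g s
  rw [cast]
  simp only [cast, e, Finset.sum_sub_distrib, Finset.sum_ite_eq, Finset.mem_univ, if_true]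
  rw [← Matrix.matrix_eq_sum_single]
  have : ∑ i, Matrix.single (0 : Fin (r + 1)) (0 : Fin (r + 1)) (x.val i i) = 0 := by
    have := map_sum (Matrix.singleLinearMap ℂ (0 : Fin (r + 1)) (0 : Fin (r + 1)))
      (fun i => x.val i i) Finset.univ
    rw [htr, map_zero] at this
    exact this.symm
  rw [this, sub_zero]

end SL

/-! ### Irreducible highest weight modules of the special linear Lie algebra -/

section Module

variable {r : ℕ} {lam : Fin (r + 1) → ℝ} {V : Type*} [AddCommGroup V] [Module ℂ V]
  [LieRingModule (slC r) V]

lemma IsGelfandTsetlin.basis_top (hlam : IsDominantIntegral lam)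
    {ξ : Module.Basis (Pattern lam) ℂ V} {v : V} (hξ : IsGelfandTsetlin v ξ) :
    ξ (topPattern hlam) = v := by
  refine hξ.top _ fun i => ?_
  rw [topPattern_weight hlam (by omega) (by omega)]
  congr 1
  exact Fin.ext (by rw [pos_val (by omega) (by omega), Nat.add_sub_cancel])

lemma IsHighestWeightVector.lie_raise {v : V} (hv : IsHighestWeightVector lam v) {k : ℕ}
    (hk : 1 ≤ k) (hkr : k ≤ r) : ⁅matUnit r k (k + 1), v⁆ = 0 := by
  refine hv.upper _ fun i j hji => ?_
  rw [val_matUnit (by omega) (by omega) (by omega), Matrix.single_apply, if_neg]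
  rintro ⟨rfl, rfl⟩
  rw [Fin.le_def, pos_val (by omega) (by omega), pos_val (by omega) (by omega)] at hji
  omega

lemma IsHighestWeightVector.lie_coroot {v : V} (hv : IsHighestWeightVector lam v) (k : ℕ) :
    ⁅coroot r k, v⁆ = ((lam (pos r k) - lam (pos r (k + 1)) : ℝ) : ℂ) • v := by
  rw [hv.weight, val_coroot]
  · congr 1
    simp [Matrix.single_apply, mul_sub, Finset.sum_sub_distrib]
  · rw [val_coroot]
    intro i j hij
    simp only [Matrix.sub_apply, Matrix.single_apply]
    rw [if_neg (by rintro ⟨rfl, h⟩; exact hij h), if_neg (by rintro ⟨rfl, h⟩; exact hij h),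
      sub_zero]

variable [LieModule ℂ (slC r) V]

/-- The `E_{k,k+1}` and `E_{k+1,k}` generate the Lie algebra. -/
lemma lie_mem_of_isStable (K : Submodule ℂ V)
    (hK : ∀ k, 1 ≤ k → k ≤ r → ∀ m ∈ K,
      ⁅matUnit r k (k + 1), m⁆ ∈ K ∧ ⁅matUnit r (k + 1) k, m⁆ ∈ K)
    (x : slC r) (m : V) (hm : m ∈ K) : ⁅x, m⁆ ∈ K := by
  let L : LieSubalgebra ℂ (slC r) :=
    { carrier := {x | ∀ m ∈ K, ⁅x, m⁆ ∈ K}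
      add_mem' := fun ha hb m hm => by rw [add_lie]; exact K.add_mem (ha m hm) (hb m hm)
      zero_mem' := fun m _ => by rw [zero_lie]; exact K.zero_mem
      smul_mem' := fun c x hx m hm => by rw [smul_lie]; exact K.smul_mem c (hx m hm)
      lie_mem' := fun {x y} hx hy m hm => by
        rw [lie_lie]; exact K.sub_mem (hx _ (hy m hm)) (hy _ (hx m hm)) }
  suffices h : x ∈ L from h m hm
  have hupper : ∀ q p, 1 ≤ p → p ≤ q → q ≤ r → matUnit r p (q + 1) ∈ L := by
    intro q p hp hpq
    induction q, hpq using Nat.le_induction with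
    | base => intro h m hm; exact (hK p hp h m hm).1
    | succ q hpq ih =>
      intro h
      rw [← lie_matUnit (q := q + 1) (by omega) (by omega) (by omega) (by omega) (by omega)
        (by omega)]
      exact L.lie_mem (ih (by omega)) fun m hm => (hK (q + 1) (by omega) h m hm).1
  have hlower : ∀ q p, 1 ≤ p → p ≤ q → q ≤ r → matUnit r (q + 1) p ∈ L := by
    intro q p hp hpq
    induction q, hpq using Nat.le_induction with
    | base => intro h m hm; exact (hK p hp h m hm).2
    | succ q hpq ih =>
      intro h
      rw [← lie_matUnit (q := q + 1) (by omega) (by omega) (by omega) (by omega) (by omega)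
        (by omega)]
      exact L.lie_mem (fun m hm => (hK (q + 1) (by omega) h m hm).2) (ih (by omega))
  have hsingle : ∀ (i j : Fin (r + 1)) (h : i ≠ j) (c : ℂ),
      LieAlgebra.SpecialLinear.single i j h c ∈ L := by
    intro i j h c
    have hpos : ∀ i : Fin (r + 1), pos r (i.val + 1) = i := fun i =>
      Fin.ext (by rw [pos_val (by omega) (by omega), Nat.add_sub_cancel])
    have hij : i.val ≠ j.val := fun h' => h (Fin.ext h')
    have e : LieAlgebra.SpecialLinear.single i j h c = c • matUnit r (i.val + 1) (j.val + 1) := by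
      apply Subtype.ext
      change Matrix.single i j c = c • (matUnit r (i.val + 1) (j.val + 1)).val
      rw [val_matUnit (by omega) (by omega) (by omega), hpos, hpos, Matrix.smul_single, smul_eq_mul,
        mul_one]
    rw [e]
    refine L.smul_mem c ?_
    rcases lt_or_gt_of_ne hij with h' | h'
    · exact hupper j.val (i.val + 1) (by omega) (by omega) (by omega)
    · exact hlower i.val (j.val + 1) (by omega) (by omega) (by omega)
  rw [eq_sum_elementary x]
  refine L.toSubmodule.sum_mem fun i _ => L.toSubmodule.sum_mem fun j _ => ?_
  change _ ∈ L
  split_ifs with h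
  · by_cases h0 : i = 0
    · have e : LieAlgebra.SpecialLinear.singleSubSingle i 0 (x.val i i) = (0 : slC r) := by
        apply Subtype.ext
        rw [LieAlgebra.SpecialLinear.val_singleSubSingle, h0, sub_self]
        rfl
      rw [e]
      exact L.zero_mem
    · have e : LieAlgebra.SpecialLinear.singleSubSingle i 0 (x.val i i) =
          ⁅LieAlgebra.SpecialLinear.single i 0 h0 (x.val i i),
            LieAlgebra.SpecialLinear.single 0 i (Ne.symm h0) (1 : ℂ)⁆ := by
        apply Subtype.ext
        rw [LieAlgebra.SpecialLinear.sl_bracket]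
        simp only [LieAlgebra.SpecialLinear.val_singleSubSingle,
          LieAlgebra.SpecialLinear.val_single, Matrix.single_mul_single_same, mul_one, one_mul]
      rw [e]
      exact L.lie_mem (hsingle _ _ _ _) (hsingle _ _ _ _)
  · exact hsingle i j h _

lemma eq_top_of_isStable [LieModule.IsIrreducible ℂ (slC r) V] (K : Submodule ℂ V)
    (hK : IsStable (fun k : Simple r => LieModule.toEnd ℂ (slC r) V (matUnit r k.1 (k.1 + 1)))
      (fun k => LieModule.toEnd ℂ (slC r) V (matUnit r (k.1 + 1) k.1)) K)
    (hne : K ≠ ⊥) : K = ⊤ := by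
  let N : LieSubmodule ℂ (slC r) V :=
    { K with lie_mem := fun {x m} hm =>
        lie_mem_of_isStable K (fun k hk hkr m hm => hK ⟨k, hk, hkr⟩ m hm) x m hm }
  have hN : N.toSubmodule = K := rfl
  have h : N = ⊤ := by
    refine (eq_bot_or_eq_top N).resolve_left fun h => hne ?_
    rw [← hN, h, LieSubmodule.bot_toSubmodule]
  rw [← hN, h, LieSubmodule.top_toSubmodule]

lemma toEnd_mul_toEnd (x y : slC r) :
    LieModule.toEnd ℂ (slC r) V x * LieModule.toEnd ℂ (slC r) V y =
      LieModule.toEnd ℂ (slC r) V y * LieModule.toEnd ℂ (slC r) V x +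
        LieModule.toEnd ℂ (slC r) V ⁅x, y⁆ := by
  refine LinearMap.ext fun m => ?_
  simp only [Module.End.mul_apply, LinearMap.add_apply, LieModule.toEnd_apply_apply]
  rw [leibniz_lie, add_comm]

lemma isChevalley_toEnd : IsChevalley (fun k l : Simple r => negCartan k.1 l.1)
    (fun k => LieModule.toEnd ℂ (slC r) V (matUnit r k.1 (k.1 + 1)))
    (fun k => LieModule.toEnd ℂ (slC r) V (matUnit r (k.1 + 1) k.1))
    (fun k => LieModule.toEnd ℂ (slC r) V (coroot r k.1)) where
  ef k l := by
    rw [toEnd_mul_toEnd, lie_raise_lower k.2 l.2]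
    simp only [Subtype.ext_iff]
    split_ifs
    · rfl
    · rw [map_zero]
  hf k l := by
    rw [toEnd_mul_toEnd, lie_coroot_lower k.2 l.2, map_smul]

lemma isLowering_toEnd {ξ : Module.Basis (Pattern lam) ℂ V} {v : V} (hξ : IsGelfandTsetlin v ξ) :
    IsLowering ξ fun p q => LieModule.toEnd ℂ (slC r) V (matUnit r p q) where
  simple k hk hkr P := hξ.lower k hk hkr P
  comm j i hi hij hj := by
    rw [toEnd_mul_toEnd, add_sub_cancel_left, lie_matUnit (by omega) (by omega) (by omega)
      (by omega) (by omega) (by omega)]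

lemma clVector_eq (v : V) (P : Pattern lam) : clVector v P =
    tailProd (fun p q => LieModule.toEnd ℂ (slC r) V (matUnit r p q)) P 1 r v := by
  have e : ∀ j i, ⌊P.ell (j + 1) i - P.ell j i⌋₊ = gap P j i := by
    intro j i
    rw [gap, Pattern.ell, Pattern.ell]
    congr 1
    ring
  simp only [clVector, rho, rhoRow, tailProd, rowProd, e]

theorem exists_isGelfandTsetlin [LieModule.IsIrreducible ℂ (slC r) V]
    (hlam : IsDominantIntegral lam) {v : V} (hv : IsHighestWeightVector lam v) :
    ∃ ξ : Module.Basis (Pattern lam) ℂ V, IsGelfandTsetlin v ξ := by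
  let η : Module.Basis (Pattern lam) ℂ (Pattern lam →₀ ℂ) := Finsupp.basisSingleOne
  obtain ⟨Φ, hΦ, hΦe, hΦf⟩ := exists_equiv_of_isChevalley
    (isChevalley_toEnd (r := r) (V := V)) (isChevalley_model η) (v := v) (w := η (topPattern hlam))
    (c := fun k => ((lam (pos r k.1) - lam (pos r (k.1 + 1)) : ℝ) : ℂ))
    hv.ne_zero (η.ne_zero _) (fun k => hv.lie_raise k.2.1 k.2.2)
    (fun k => raiseOp_top η hlam k.2.2) (fun k => hv.lie_coroot k.1)
    (fun k => by
      rw [cartanOp_basis, topPattern_weight hlam k.2.1 (by have := k.2; omega),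
        topPattern_weight hlam (by omega) (by have := k.2; omega)])
    eq_top_of_isStable (simple_model η hlam)
    (LieModule.toEnd ℂ (slC r) V (gradingElement r))
    (∑ i, (lam i : ℂ) * (gradingElement r).val i i)
    (hv.weight _ (Matrix.isDiag_diagonal _))
    (fun k => by
      rw [toEnd_mul_toEnd, lie_gradingElement_lower k.2, map_neg, sub_eq_add_neg])
    (η.coord (topPattern hlam)) (by simp) (fun k x => coord_top_lowerOp η hlam k.2.1 k.2.2 x)
  have hext : ∀ f, Φ (extendZero η f) = extendZero (η.map Φ) f := by
    intro f
    rw [extendZero, extendZero]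
    split_ifs
    · rw [Module.Basis.map_apply]
    · rw [map_zero]
  have hmap : ∀ P, η.map Φ P = Φ (η P) := fun P => Module.Basis.map_apply _ _ _
  have hraise : ∀ k, 1 ≤ k → k ≤ r → ∀ x, Φ (raiseOp η k x) = ⁅matUnit r k (k + 1), Φ x⁆ :=
    fun k hk hkr x => hΦe ⟨k, hk, hkr⟩ x
  have hlower : ∀ k, 1 ≤ k → k ≤ r → ∀ x, Φ (lowerOp η k x) = ⁅matUnit r (k + 1) k, Φ x⁆ :=
    fun k hk hkr x => hΦf ⟨k, hk, hkr⟩ x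
  refine ⟨η.map Φ, ?_, ?_, ?_, ?_⟩
  · intro P hP
    rw [eq_topPattern_of_weight hlam P hP, hmap, hΦ]
  · intro k hk hkr P
    have h := LinearMap.congr_fun (raiseOp_lowerOp_self η hk hkr) (η P)
    rw [LinearMap.add_apply, Module.End.mul_apply, Module.End.mul_apply, cartanOp_basis] at h
    have h' := congrArg Φ h
    have hc : coroot r k = ⁅matUnit r k (k + 1), matUnit r (k + 1) k⁆ := by
      rw [lie_raise_lower ⟨hk, hkr⟩ ⟨hk, hkr⟩, if_pos rfl]
    rw [map_add, hraise k hk hkr, hlower k hk hkr, hlower k hk hkr, hraise k hk hkr, map_smul,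
      ← sub_eq_iff_eq_add', ← lie_lie, ← hc] at h'
    rw [hmap, h']
  · intro k hk hkr P
    rw [hmap, ← hraise k hk hkr, raiseOp_basis, map_neg, map_sum]
    simp only [map_smul, hext]
  · intro k hk hkr P
    rw [hmap, ← hlower k hk hkr, lowerOp_basis, map_sum]
    simp only [map_smul, hext]

end Module

end GTCL

end

theorem mainTheorem1 (r : ℕ) (lam : Fin (r + 1) → ℝ) (hlam : GTCL.IsDominantIntegral lam)
    (V : Type*) [AddCommGroup V] [Module ℂ V] [LieRingModule (GTCL.slC r) V]
    [LieModule ℂ (GTCL.slC r) V] [LieModule.IsIrreducible ℂ (GTCL.slC r) V]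
    (v : V) (hv : GTCL.IsHighestWeightVector lam v) :
    ∃ b : Module.Basis (GTCL.Pattern lam) ℂ V,
      (∀ P, b P = GTCL.clVector v P) ∧
      (∃ ξ : Module.Basis (GTCL.Pattern lam) ℂ V, GTCL.IsGelfandTsetlin v ξ) ∧
      ∀ ξ : Module.Basis (GTCL.Pattern lam) ℂ V, GTCL.IsGelfandTsetlin v ξ →
        ∀ P : GTCL.Pattern lam,
          (∀ P' : GTCL.Pattern lam, ¬ P ≤ P' → ξ.toMatrix b P' P = 0) ∧
          ξ.toMatrix b P P = GTCL.diagCoeff P := by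
  obtain ⟨ξ, hξ⟩ := GTCL.exists_isGelfandTsetlin hlam hv
  have hcl : ∀ ξ : Module.Basis (GTCL.Pattern lam) ℂ V, GTCL.IsGelfandTsetlin v ξ →
      ∀ P : GTCL.Pattern lam,
      GTCL.clVector v P = GTCL.tailProd
        (fun p q => LieModule.toEnd ℂ (GTCL.slC r) V (GTCL.matUnit r p q)) P 1 r
        (ξ (GTCL.topPattern hlam)) := fun ξ hξ P => by
    rw [GTCL.IsGelfandTsetlin.basis_top hlam hξ, GTCL.clVector_eq v P]
  have hspan : ⊤ ≤ Submodule.span ℂ (Set.range (GTCL.clVector (lam := lam) v)) := by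
    rw [funext (hcl ξ hξ), (GTCL.isLowering_toEnd hξ).span_eq_top hlam]
  have hli : LinearIndependent ℂ (GTCL.clVector (lam := lam) v) :=
    linearIndependent_of_top_le_span_of_card_eq_finrank hspan (Module.finrank_eq_card_basis ξ).symm
  refine ⟨Module.Basis.mk hli hspan, fun P => Module.Basis.mk_apply hli hspan P, ⟨ξ, hξ⟩,
    fun ξ hξ P => ⟨fun P' hP' => ?_, ?_⟩⟩
  · rw [Module.Basis.toMatrix_apply, Module.Basis.mk_apply, hcl ξ hξ]
    by_contra h
    exact hP' ((GTCL.isLowering_toEnd hξ).le_of_repr_ne_zero hlam P P' h)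
  · rw [Module.Basis.toMatrix_apply, Module.Basis.mk_apply, hcl ξ hξ]
    exact (GTCL.isLowering_toEnd hξ).repr_self hlam P
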